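/- Let $\mathbb D$ be the open unit disk of $\mathbb C$ with the normalized area measure $d\mathscr A=\frac{dx\,dy}{\pi}$, and let $\phi\colon\mathbb D\to\mathbb D$ be analytic. An Orlicz function is a non-decreasing, strictly convex function $\Psi\colon[0,\infty)\to[0,\infty)$, continuous at $0$, with $\Psi(0)=0$ and $\Psi(x)/x\to\infty$ as $x\to\infty$; it is a bijection of $[0,\infty)$, with inverse $\Psi^{-1}$. We write $\Psi\in\Delta^2$ if there is $\alpha>1$ such that $\Psi(x)^2\le\Psi(\alpha x)$ for all large enough $x$. The Bergman–Orlicz space $\mathscr B^\Psi$ is the space of analytic functions $f\colon\mathbb D\to\mathbb C$ such that $\int_{\mathbb D}\Psi(|f|/C)\,d\mathscr A<\infty$ for some $C>0$, with the Luxemburg norm $\|f\|_\Psi=\inf\{C>0 : \int_{\mathbb D}\Psi(|f|/C)\,d\mathscr A\le1\}$, and $C_\phi f=f\circ\phi$. 1. For every Orlicz function $\Psi$: if $C_\phi\colon\mathscr B^\Psi\to\mathscr B^\Psi$ is compact, then $$\frac{\Psi^{-1}\big(1/(1-|\phi(a)|)^2\big)}{\Psi^{-1}\big(1/(1-|a|)^2\big)}\longrightarrow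 0\qquad\text{as } |a|\to1,\ |a|<1.\tag{$*$}$$ 2. If $\Psi\in\Delta^2$ and $(*)$ holds, then $C_\phi\colon\mathscr B^\Psi\to\mathscr B^\Psi$ is (bounded and) compact. 3. For $\Psi=\Psi_2$, $\Psi_2(x)=e^{x^2}-1$, condition $(*)$ holds if and only if for every $\varepsilon>0$ there is $c_\varepsilon>0$ such that $$1-|\phi(z)|\ge c_\varepsilon(1-|z|)^\varepsilon\qquad\text{for all } z\in\mathbb D,$$ and this is in turn equivalent to the compactness of $C_\phi\colon\mathscr B^{\Psi_2}\to\mathscr B^{\Psi_2}$. -/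

import Mathlib

open MeasureTheory Set Filter Topology

noncomputable section

/-- Orlicz functions. Strict convexity forces finiteness on `[0, ∞)`, so an Orlicz function is given
by its restriction to `[0, ∞)`; the values of `toFun` at negative reals play no role. -/
structure OrliczFunction where
  toFun : ℝ → ℝ
  map_zero' : toFun 0 = 0
  monotoneOn' : MonotoneOn toFun (Ici 0)
  strictConvexOn' : StrictConvexOn ℝ (Ici 0) toFun
  continuousWithinAt_zero' : ContinuousWithinAt toFun (Ici 0) 0
  tendsto_div' : Tendsto (fun x => toFun x / x) atTop atTop

namespace OrliczFunction

instance : CoeFun OrliczFunction (fun _ => ℝ → ℝ) := ⟨toFun⟩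

/-- The inverse `Ψ⁻¹ : [0, ∞) → [0, ∞)` of the bijection `Ψ : [0, ∞) → [0, ∞)`. -/
def inv (Ψ : OrliczFunction) : ℝ → ℝ := Function.invFunOn Ψ (Ici 0)

/-- The fast growth condition `Δ²`. -/
def DeltaSq (Ψ : OrliczFunction) : Prop :=
  ∃ α : ℝ, 1 < α ∧ ∀ᶠ x in atTop, Ψ x ^ 2 ≤ Ψ (α * x)

lemma nonneg (Ψ : OrliczFunction) {x : ℝ} (hx : 0 ≤ x) : 0 ≤ Ψ x :=
  Ψ.map_zero' ▸ Ψ.monotoneOn' self_mem_Ici hx hx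

lemma pos (Ψ : OrliczFunction) {x : ℝ} (hx : 0 < x) : 0 < Ψ x := by
  have h := Ψ.strictConvexOn'.2 (self_mem_Ici (a := (0 : ℝ))) (mem_Ici.2 hx.le) hx.ne
    (show (0 : ℝ) < 1 / 2 by norm_num) (show (0 : ℝ) < 1 / 2 by norm_num) (by norm_num)
  have h2 := Ψ.nonneg (x := (1 / 2 : ℝ) • (0 : ℝ) + (1 / 2 : ℝ) • x)
    (by simp only [smul_eq_mul]; linarith)
  rw [Ψ.map_zero'] at h
  simp only [smul_eq_mul] at h h2
  linarith

lemma le_mul (Ψ : OrliczFunction) {x t : ℝ} (hx : 0 ≤ x) (ht : 0 ≤ t) (ht1 : t ≤ 1) :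
    Ψ (t * x) ≤ t * Ψ x := by
  have h := Ψ.strictConvexOn'.convexOn.2 (self_mem_Ici (a := (0 : ℝ))) (mem_Ici.2 hx)
    (show 0 ≤ 1 - t by linarith) ht (by ring)
  simpa [Ψ.map_zero'] using h

lemma measurable_comp (Ψ : OrliczFunction) {α : Type*} [MeasurableSpace α] {g : α → ℝ}
    (hg : Measurable g) (h0 : ∀ a, 0 ≤ g a) : Measurable (fun a => Ψ (g a)) := by
  have hm : Monotone (fun x : ℝ => Ψ (max x 0)) := fun x y h =>
    Ψ.monotoneOn' (mem_Ici.2 (le_max_right _ _)) (mem_Ici.2 (le_max_right _ _)) (max_le_max_right _ h)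
  have h := hm.measurable.comp hg
  have he : (fun a => Ψ (g a)) = (fun x : ℝ => Ψ (max x 0)) ∘ g := by
    funext a
    simp [h0 a]
  rwa [he]

lemma bijOn (Ψ : OrliczFunction) : BijOn Ψ (Ici 0) (Ici 0) := by
  refine ⟨fun x hx => Ψ.nonneg hx, StrictMonoOn.injOn (fun x hx y hy hxy => ?_), fun y hy => ?_⟩
  · have hx0 : (0 : ℝ) ≤ x := hx
    have hy0 : 0 < y := hx0.trans_lt hxy
    have h := Ψ.le_mul hy0.le (div_nonneg hx0 hy0.le) ((div_le_one hy0).2 hxy.le)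
    rw [div_mul_cancel₀ _ hy0.ne'] at h
    have := mul_lt_mul_of_pos_right ((div_lt_one hy0).2 hxy) (Ψ.pos hy0)
    linarith
  · have hcont : ContinuousOn Ψ (Ici 0) := by
      intro x hx
      rcases eq_or_lt_of_le (mem_Ici.1 hx) with rfl | hx'
      · exact Ψ.continuousWithinAt_zero'
      · have := Ψ.strictConvexOn'.convexOn.continuousOn_interior
        rw [interior_Ici] at this
        exact (this.continuousAt (Ioi_mem_nhds hx')).continuousWithinAt
    obtain ⟨x, hx1, hx⟩ := ((eventually_ge_atTop (max 1 y)).and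
      (Ψ.tendsto_div'.eventually_ge_atTop 1)).exists
    have hx0 : 0 < x := one_pos.trans_le ((le_max_left _ _).trans hx1)
    rw [le_div_iff₀ hx0, one_mul] at hx
    obtain ⟨z, hz, hzy⟩ := intermediate_value_Icc hx0.le (hcont.mono Icc_subset_Ici_self)
      ⟨Ψ.map_zero'.trans_le hy, ((le_max_right _ _).trans hx1).trans hx⟩
    exact ⟨z, hz.1, hzy⟩

/-- The Orlicz function `Ψ₂(x) = exp(x²) - 1`. -/
def expSq : OrliczFunction where
  toFun x := Real.exp (x ^ 2) - 1
  map_zero' := by simp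
  monotoneOn' := by
    intro x hx y _ hxy
    have h : x ^ 2 ≤ y ^ 2 := pow_le_pow_left₀ hx hxy 2
    simpa using h
  strictConvexOn' := by
    have h : StrictConvexOn ℝ (Ici 0) (Real.exp ∘ fun x : ℝ => x ^ 2) := by
      refine ⟨convex_Ici 0, ?_⟩
      intro x hx y hy hxy a b ha hb hab
      have h1 := (strictConvexOn_pow (n := 2) le_rfl).2 hx hy hxy ha hb hab
      have h2 := convexOn_exp.2 (mem_univ (x ^ 2)) (mem_univ (y ^ 2)) ha.le hb.le hab
      exact (Real.exp_lt_exp.2 h1).trans_le h2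
    have h' := h.add_const (-1)
    simp only [sub_eq_add_neg]
    exact h'
  continuousWithinAt_zero' := by
    apply Continuous.continuousWithinAt
    fun_prop
  tendsto_div' := by
    refine tendsto_atTop_mono' _ ?_ tendsto_id
    filter_upwards [eventually_gt_atTop 0] with x hx
    have := Real.add_one_le_exp (x ^ 2)
    rw [le_div_iff₀ hx]
    simp only [id]
    nlinarith

end OrliczFunction

/-- The open unit disk of the complex plane. -/
abbrev Disk : Type := ↥(Metric.ball (0 : ℂ) 1)

namespace Disk

/-- Analytic functions on the open unit disk. -/
def Analytic (f : Disk → ℂ) : Prop :=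
  ∃ F : ℂ → ℂ, DifferentiableOn ℂ F (Metric.ball 0 1) ∧ ∀ z : Disk, f z = F z

lemma Analytic.continuous {f : Disk → ℂ} (hf : Analytic f) : Continuous f := by
  obtain ⟨F, hF, h⟩ := hf
  have : f = (Metric.ball (0 : ℂ) 1).domRestrict F := funext h
  rw [this]
  exact hF.continuousOn.domRestrict

/-- The normalized area measure `dx dy / π` on the unit disk. -/
def area : Measure Disk :=
  (ENNReal.ofReal Real.pi)⁻¹ • Measure.comap (Subtype.val : Disk → ℂ) volume

lemma area_open_pos {U : Set Disk} (hU : IsOpen U) (h : area U = 0) : U = ∅ := by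
  have hm : MeasurableEmbedding (Subtype.val : Disk → ℂ) :=
    MeasurableEmbedding.subtype_coe measurableSet_ball
  rw [area, Measure.smul_apply, hm.comap_apply, smul_eq_mul, mul_eq_zero] at h
  have h' := h.resolve_left (by simp)
  have ho : IsOpen ((Subtype.val : Disk → ℂ) '' U) :=
    Metric.isOpen_ball.isOpenMap_subtype_val U hU
  exact image_eq_empty.1 ((ho.measure_eq_zero_iff volume).1 h')

end Disk

/-- The modular `∫ Ψ(|f| / C) d𝒜`. -/
def orliczModular (Ψ : OrliczFunction) (f : Disk → ℂ) (C : ℝ) : ENNReal :=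
  ∫⁻ z, ENNReal.ofReal (Ψ (‖f z‖ / C)) ∂Disk.area

/-- The Luxemburg norm. -/
def luxemburgNorm (Ψ : OrliczFunction) (f : Disk → ℂ) : ℝ :=
  sInf {C : ℝ | 0 < C ∧ orliczModular Ψ f C ≤ 1}

lemma orliczModular_add_le (Ψ : OrliczFunction) {f g : Disk → ℂ} (hf : Continuous f)
    {C D : ℝ} (hC : 0 < C) (hD : 0 < D) :
    orliczModular Ψ (f + g) (C + D) ≤
      ENNReal.ofReal (C / (C + D)) * orliczModular Ψ f C
        + ENNReal.ofReal (D / (C + D)) * orliczModular Ψ g D := by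
  have hCD : 0 < C + D := add_pos hC hD
  have hmf : Measurable fun z => ENNReal.ofReal (Ψ (‖f z‖ / C)) :=
    (Ψ.measurable_comp (hf.norm.measurable.div_const C) fun z => by positivity).ennreal_ofReal
  unfold orliczModular
  rw [← lintegral_const_mul _ hmf, ← lintegral_const_mul' _ _ ENNReal.ofReal_ne_top,
    ← lintegral_add_left (hmf.const_mul _)]
  refine lintegral_mono fun z => ?_
  have hf0 : 0 ≤ ‖f z‖ / C := by positivity
  have hg0 : 0 ≤ ‖g z‖ / D := by positivity
  rw [← ENNReal.ofReal_mul (by positivity), ← ENNReal.ofReal_mul (by positivity),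
    ← ENNReal.ofReal_add (mul_nonneg (by positivity) (Ψ.nonneg hf0))
      (mul_nonneg (by positivity) (Ψ.nonneg hg0))]
  refine ENNReal.ofReal_le_ofReal ?_
  have hc := Ψ.strictConvexOn'.convexOn.2 (mem_Ici.2 hf0) (mem_Ici.2 hg0)
    (show 0 ≤ C / (C + D) by positivity) (show 0 ≤ D / (C + D) by positivity) (by field_simp)
  simp only [smul_eq_mul] at hc
  refine le_trans (Ψ.monotoneOn' (mem_Ici.2 (by positivity)) (mem_Ici.2 (by positivity)) ?_) hc
  have : C / (C + D) * (‖f z‖ / C) + D / (C + D) * (‖g z‖ / D) = (‖f z‖ + ‖g z‖) / (C + D) := by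
    field_simp
  rw [this]
  gcongr
  exact norm_add_le _ _

lemma orliczModular_mul_le (Ψ : OrliczFunction) (f : Disk → ℂ) {C N : ℝ} (hC : 0 < C)
    (hN : 1 ≤ N) :
    orliczModular Ψ f (C * N) ≤ ENNReal.ofReal N⁻¹ * orliczModular Ψ f C := by
  have hN0 : 0 < N := by linarith
  unfold orliczModular
  rw [← lintegral_const_mul' _ _ ENNReal.ofReal_ne_top]
  refine lintegral_mono fun z => ?_
  rw [← ENNReal.ofReal_mul (by positivity)]
  refine ENNReal.ofReal_le_ofReal ?_
  have : ‖f z‖ / (C * N) = N⁻¹ * (‖f z‖ / C) := by field_simp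
  rw [this]
  exact Ψ.le_mul (by positivity) (by positivity) (inv_le_one_of_one_le₀ hN)

lemma orliczModular_smul (Ψ : OrliczFunction) (f : Disk → ℂ) {c : ℂ} (hc : c ≠ 0) (C : ℝ) :
    orliczModular Ψ (c • f) (‖c‖ * C) = orliczModular Ψ f C := by
  unfold orliczModular
  refine lintegral_congr fun z => ?_
  have : ‖c‖ ≠ 0 := norm_ne_zero_iff.2 hc
  simp only [Pi.smul_apply, smul_eq_mul, norm_mul]
  rw [mul_div_mul_left _ _ this]

lemma orliczModular_zero (Ψ : OrliczFunction) (C : ℝ) : orliczModular Ψ 0 C = 0 := by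
  simp [orliczModular, Ψ.map_zero']

lemma exists_orliczModular_le_one (Ψ : OrliczFunction) {f : Disk → ℂ} {C : ℝ} (hC : 0 < C)
    (h : orliczModular Ψ f C < ⊤) :
    {C : ℝ | 0 < C ∧ orliczModular Ψ f C ≤ 1}.Nonempty := by
  set M := (orliczModular Ψ f C).toReal with hM
  have hM0 : 0 ≤ M := ENNReal.toReal_nonneg
  refine ⟨C * (M + 1), by positivity,
    (orliczModular_mul_le Ψ f hC (by linarith)).trans ?_⟩
  rw [← ENNReal.ofReal_toReal h.ne, ← hM, ← ENNReal.ofReal_mul (by positivity),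
    ENNReal.ofReal_le_one, inv_mul_le_iff₀ (by positivity)]
  linarith

lemma luxemburgNorm_bddBelow (Ψ : OrliczFunction) (f : Disk → ℂ) :
    BddBelow {C : ℝ | 0 < C ∧ orliczModular Ψ f C ≤ 1} := ⟨0, fun _ h => h.1.le⟩

/-- The analytic functions on the disk that belong to the Orlicz space `L^Ψ(𝔻, 𝒜)`, as a linear
subspace of the space of all functions on the disk. -/
def bergmanOrliczSubmodule (Ψ : OrliczFunction) : Submodule ℂ (Disk → ℂ) where
  carrier := {f | Disk.Analytic f ∧ ∃ C : ℝ, 0 < C ∧ orliczModular Ψ f C < ⊤}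
  zero_mem' := ⟨⟨0, differentiableOn_const 0, fun _ => rfl⟩, 1, one_pos, by
    simp [orliczModular_zero]⟩
  add_mem' := by
    rintro f g ⟨hf, C, hC, hfC⟩ ⟨hg, D, hD, hgD⟩
    refine ⟨?_, C + D, add_pos hC hD, (orliczModular_add_le Ψ hf.continuous hC hD).trans_lt ?_⟩
    · obtain ⟨F, hF, hfF⟩ := hf
      obtain ⟨G, hG, hgG⟩ := hg
      exact ⟨F + G, hF.add hG, fun z => by simp [hfF, hgG]⟩
    · exact ENNReal.add_lt_top.2 ⟨ENNReal.mul_lt_top ENNReal.ofReal_lt_top hfC,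
        ENNReal.mul_lt_top ENNReal.ofReal_lt_top hgD⟩
  smul_mem' := by
    rintro c f ⟨⟨F, hF, hfF⟩, C, hC, hfC⟩
    refine ⟨⟨c • F, hF.const_smul c, fun z => by simp [hfF]⟩, ?_⟩
    rcases eq_or_ne c 0 with rfl | hc
    · exact ⟨1, one_pos, by simp [orliczModular_zero]⟩
    · exact ⟨‖c‖ * C, mul_pos (norm_pos_iff.2 hc) hC, by rwa [orliczModular_smul Ψ f hc]⟩

/-- The Bergman–Orlicz space `𝓑^Ψ`. It is a type of its own, so that its topology is the one of the
Luxemburg norm below and not that of pointwise convergence. -/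
def BergmanOrlicz (Ψ : OrliczFunction) : Type := ↥(bergmanOrliczSubmodule Ψ)

namespace BergmanOrlicz

variable {Ψ : OrliczFunction}

instance : AddCommGroup (BergmanOrlicz Ψ) :=
  inferInstanceAs (AddCommGroup ↥(bergmanOrliczSubmodule Ψ))

instance : Module ℂ (BergmanOrlicz Ψ) :=
  inferInstanceAs (Module ℂ ↥(bergmanOrliczSubmodule Ψ))

instance : CoeFun (BergmanOrlicz Ψ) (fun _ => Disk → ℂ) := ⟨fun f => f.1⟩

instance : Norm (BergmanOrlicz Ψ) := ⟨fun f => luxemburgNorm Ψ f⟩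

lemma norm_def (f : BergmanOrlicz Ψ) : ‖f‖ = luxemburgNorm Ψ f := rfl

lemma nonempty_set (f : BergmanOrlicz Ψ) :
    {C : ℝ | 0 < C ∧ orliczModular Ψ f C ≤ 1}.Nonempty := by
  obtain ⟨-, C, hC, h⟩ := f.2
  exact exists_orliczModular_le_one Ψ hC h

lemma norm_nonneg' (f : BergmanOrlicz Ψ) : 0 ≤ ‖f‖ :=
  Real.sInf_nonneg fun _ h => h.1.le

lemma norm_add_le' (f g : BergmanOrlicz Ψ) : ‖f + g‖ ≤ ‖f‖ + ‖g‖ := by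
  refine le_of_forall_pos_le_add fun ε hε => ?_
  obtain ⟨C, ⟨hC, hfC⟩, hCε⟩ := exists_lt_of_csInf_lt f.nonempty_set
    (show luxemburgNorm Ψ f < luxemburgNorm Ψ f + ε / 2 by linarith)
  obtain ⟨D, ⟨hD, hgD⟩, hDε⟩ := exists_lt_of_csInf_lt g.nonempty_set
    (show luxemburgNorm Ψ g < luxemburgNorm Ψ g + ε / 2 by linarith)
  have hCD : 0 < C + D := add_pos hC hD
  have h : orliczModular Ψ ((f : Disk → ℂ) + g) (C + D) ≤ 1 := by
    refine (orliczModular_add_le Ψ f.2.1.continuous hC hD).trans ?_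
    calc _ ≤ ENNReal.ofReal (C / (C + D)) * 1 + ENNReal.ofReal (D / (C + D)) * 1 := by gcongr
      _ = 1 := by
        rw [mul_one, mul_one, ← ENNReal.ofReal_add (by positivity) (by positivity), ← add_div,
          div_self hCD.ne', ENNReal.ofReal_one]
  have h2 : ‖f + g‖ ≤ C + D := csInf_le (luxemburgNorm_bddBelow Ψ _) ⟨hCD, h⟩
  rw [norm_def f, norm_def g]
  linarith

lemma norm_zero' : ‖(0 : BergmanOrlicz Ψ)‖ = 0 := by
  refine le_antisymm (le_of_forall_pos_le_add fun ε hε => ?_) (norm_nonneg' _)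
  rw [zero_add]
  exact csInf_le (luxemburgNorm_bddBelow Ψ _) ⟨hε, (orliczModular_zero Ψ ε).trans_le zero_le_one⟩

lemma norm_smul_le' (c : ℂ) (f : BergmanOrlicz Ψ) : ‖c • f‖ ≤ ‖c‖ * ‖f‖ := by
  rcases eq_or_ne c 0 with rfl | hc
  · rw [zero_smul, norm_zero', norm_zero, zero_mul]
  · have hc' : 0 < ‖c‖ := norm_pos_iff.2 hc
    rw [← div_le_iff₀' hc']
    refine le_csInf f.nonempty_set fun C hC => ?_
    rw [div_le_iff₀' hc']
    exact csInf_le (luxemburgNorm_bddBelow Ψ _)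
      ⟨mul_pos hc' hC.1, (orliczModular_smul Ψ f hc C).trans_le hC.2⟩

lemma norm_smul' (c : ℂ) (f : BergmanOrlicz Ψ) : ‖c • f‖ = ‖c‖ * ‖f‖ := by
  refine le_antisymm (norm_smul_le' c f) ?_
  rcases eq_or_ne c 0 with rfl | hc
  · rw [norm_zero, zero_mul]; exact norm_nonneg' _
  · have hc' : 0 < ‖c‖ := norm_pos_iff.2 hc
    have h := norm_smul_le' c⁻¹ (c • f)
    rw [inv_smul_smul₀ hc, norm_inv] at h
    rwa [le_inv_mul_iff₀ hc'] at h

lemma eq_zero_of_norm_eq_zero {f : BergmanOrlicz Ψ} (h : ‖f‖ = 0) : f = 0 := by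
  have key : ∀ ε : ℝ, 0 < ε → ε ≤ 1 → orliczModular Ψ f 1 ≤ ENNReal.ofReal ε := by
    intro ε hε hε1
    obtain ⟨C, ⟨hC, hfC⟩, hCε⟩ := exists_lt_of_csInf_lt f.nonempty_set
      (show luxemburgNorm Ψ f < ε by rw [← norm_def, h]; exact hε)
    have h1 : 1 ≤ C⁻¹ := (one_le_inv₀ hC).2 (hCε.le.trans hε1)
    have h2 := orliczModular_mul_le Ψ f hC h1
    rw [mul_inv_cancel₀ hC.ne', inv_inv] at h2
    calc _ ≤ _ := h2
      _ ≤ ENNReal.ofReal C * 1 := by gcongr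
      _ ≤ _ := by rw [mul_one]; exact ENNReal.ofReal_le_ofReal hCε.le
  have hz : orliczModular Ψ f 1 = 0 := by
    refine le_antisymm (ENNReal.le_of_forall_pos_le_add fun ε hε _ => ?_) zero_le
    have := key (min ε 1) (lt_min (by exact_mod_cast hε) one_pos) (min_le_right _ _)
    rw [zero_add]
    exact this.trans (by
      rw [← ENNReal.ofReal_coe_nnreal]; exact ENNReal.ofReal_le_ofReal (min_le_left _ _))
  have hcont : Continuous (f : Disk → ℂ) := f.2.1.continuous
  have hm : Measurable fun z => ENNReal.ofReal (Ψ (‖f z‖ / 1)) :=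
    (Ψ.measurable_comp (hcont.norm.measurable.div_const 1) fun z => by positivity).ennreal_ofReal
  have hae := (lintegral_eq_zero_iff hm).1 hz
  have hU : Disk.area {z | f z ≠ 0} = 0 := by
    refine measure_mono_null (fun z hz' => ?_) (ae_iff.1 hae)
    have : 0 < Ψ (‖f z‖ / 1) := Ψ.pos (by rw [div_one]; exact norm_pos_iff.2 hz')
    simpa using this
  have hemp := Disk.area_open_pos (isOpen_ne_fun hcont continuous_const) hU
  apply Subtype.ext
  funext z
  by_contra hne
  exact (hemp ▸ (show z ∈ {z | f z ≠ 0} from hne) : z ∈ (∅ : Set Disk))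

lemma core : NormedSpace.Core ℂ (BergmanOrlicz Ψ) where
  norm_nonneg := norm_nonneg'
  norm_smul := norm_smul'
  norm_triangle := norm_add_le'
  norm_eq_zero_iff _ := ⟨eq_zero_of_norm_eq_zero, fun h => h ▸ norm_zero'⟩

instance : NormedAddCommGroup (BergmanOrlicz Ψ) := NormedAddCommGroup.ofCore core

instance : NormedSpace ℂ (BergmanOrlicz Ψ) := NormedSpace.ofCore core

end BergmanOrlicz

/-- `C_φ : f ↦ f ∘ φ` maps `𝓑^Ψ` into itself, boundedly, and is a compact operator there. The
continuous linear map `T` is determined by `φ`. -/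
def IsCompactCompositionOperator (Ψ : OrliczFunction) (φ : Disk → Disk) : Prop :=
  ∃ T : BergmanOrlicz Ψ →L[ℂ] BergmanOrlicz Ψ,
    (∀ (f : BergmanOrlicz Ψ) (z : Disk), T f z = f (φ z)) ∧ IsCompactOperator T

/-- `Ψ⁻¹(1 / (1 - |φ(a)|)²) / Ψ⁻¹(1 / (1 - |a|)²) → 0` as `|a| → 1`, `|a| < 1`. -/
def BergmanCompactCondition (Ψ : OrliczFunction) (φ : Disk → Disk) : Prop :=
  Tendsto (fun a : Disk => Ψ.inv (1 / (1 - ‖(φ a : ℂ)‖) ^ 2) / Ψ.inv (1 / (1 - ‖(a : ℂ)‖) ^ 2))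
    (comap (fun a : Disk => ‖(a : ℂ)‖) (𝓝[<] 1)) (𝓝 0)

/-- For every `ε > 0` there is `c > 0` with `1 - |φ(z)| ≥ c (1 - |z|)^ε` for all `z` in the disk. -/
def PowerCondition (φ : Disk → Disk) : Prop :=
  ∀ ε : ℝ, 0 < ε → ∃ c : ℝ, 0 < c ∧ ∀ z : Disk, c * (1 - ‖(z : ℂ)‖) ^ ε ≤ 1 - ‖(φ z : ℂ)‖

end

/-!
Applying the mean value inequality to `Ψ ∘ |f|` on the largest disk centred at `a` shows that the
unit ball of `𝓑^Ψ` satisfies `|f(a)| ≤ G(a) := Ψ⁻¹(1 / (1 - |a|)²)`, and up to a constant the bound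
is attained at `b` by `G(b)` times a peak function `g_b` with `|g_b| ≤ 1` and
`∫ |g_b| d𝒜 ≤ (1 - |b|)²`. These test functions tend to `0` pointwise as `|b| → 1`. If `C_φ` is
compact, their images therefore tend to `0` in norm, and evaluating the image of the test function
at `φ(a)` in the point `a` bounds `G(φ(a)) / G(a)` by a quantity tending to `0`.

Conversely, the analytic functions with `|f| ≤ G` form a set which is compact for pointwise
convergence, by the theorem of Montel, and contains the unit ball. Under `Δ²` the function `G`
belongs to `L^Ψ`. Condition (*) says that `|f ∘ φ|` is then at most a small multiple of `G` where
`φ` is near the unit circle; elsewhere pointwise convergence in this set is uniform. Hence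
`f ↦ f ∘ φ` is continuous from that compact set to `𝓑^Ψ`.

For `Ψ₂` the number `G(a)²` differs from `-2 log(1 - |a|)` by at most `log 2`, and (*) says that
`G(φ(a))² ≤ ε G(a)² + O_ε(1)` for every `ε > 0`.
-/

namespace OrliczFunction

variable (Ψ : OrliczFunction)

lemma strictMonoOn : StrictMonoOn Ψ (Ici 0) :=
  Ψ.monotoneOn'.strictMonoOn_of_injOn Ψ.bijOn.injOn

lemma convexOn : ConvexOn ℝ (Ici 0) Ψ := Ψ.strictConvexOn'.convexOn

lemma continuousOn : ContinuousOn Ψ (Ici 0) := by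
  intro x hx
  rcases (mem_Ici.1 hx).eq_or_lt with rfl | hx_pos
  · exact Ψ.continuousWithinAt_zero'
  · have h := Ψ.convexOn.continuousOn_interior
    rw [interior_Ici] at h
    exact (h.continuousAt (Ioi_mem_nhds hx_pos)).continuousWithinAt

variable {Ψ}

lemma inv_nonneg {y : ℝ} (hy : 0 ≤ y) : 0 ≤ Ψ.inv y :=
  Function.invFunOn_mem (Ψ.bijOn.surjOn hy)

lemma apply_inv {y : ℝ} (hy : 0 ≤ y) : Ψ (Ψ.inv y) = y :=
  Function.invFunOn_eq (Ψ.bijOn.surjOn hy)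

lemma le_inv_iff {x y : ℝ} (hx : 0 ≤ x) (hy : 0 ≤ y) : x ≤ Ψ.inv y ↔ Ψ x ≤ y := by
  rw [← Ψ.strictMonoOn.le_iff_le hx (inv_nonneg hy), apply_inv hy]

lemma inv_le_iff {x y : ℝ} (hx : 0 ≤ x) (hy : 0 ≤ y) : Ψ.inv y ≤ x ↔ y ≤ Ψ x := by
  rw [← Ψ.strictMonoOn.le_iff_le (inv_nonneg hy) hx, apply_inv hy]

lemma monotoneOn_inv : MonotoneOn Ψ.inv (Ici 0) := fun x hx y hy hxy => by
  rwa [le_inv_iff (inv_nonneg hx) hy, apply_inv hx]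

lemma inv_pos {y : ℝ} (hy : 0 < y) : 0 < Ψ.inv y := by
  refine (inv_nonneg hy.le).lt_of_ne fun h => hy.ne ?_
  rw [← apply_inv (Ψ := Ψ) hy.le, ← h, Ψ.map_zero']

lemma tendsto_inv_atTop : Tendsto Ψ.inv atTop atTop := by
  refine tendsto_atTop.2 fun b => ?_
  have hb : 0 ≤ max b 0 := le_max_right _ _
  filter_upwards [eventually_ge_atTop (Ψ (max b 0))] with y hy
  exact (le_max_left b 0).trans ((le_inv_iff hb ((Ψ.nonneg hb).trans hy)).2 hy)

lemma inv_le_mul {t : ℝ} (ht : 1 ≤ t) : Ψ.inv t ≤ t * Ψ.inv 1 := by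
  have ht_pos : 0 < t := one_pos.trans_le ht
  have h_inv : 0 ≤ Ψ.inv 1 := inv_nonneg zero_le_one
  have h := Ψ.le_mul (mul_nonneg ht_pos.le h_inv) (_root_.inv_nonneg.2 ht_pos.le)
    (inv_le_one_of_one_le₀ ht)
  rw [inv_mul_cancel_left₀ ht_pos.ne', apply_inv zero_le_one, le_inv_mul_iff₀ ht_pos,
    mul_one] at h
  exact (inv_le_iff (by positivity) ht_pos.le).2 h

end OrliczFunction

section MeanValue

variable {E : Type*} [NormedAddCommGroup E]

lemma map_circleAverage_le [NormedSpace ℝ E] [CompleteSpace E] {g : E → ℝ} {f : ℂ → E} {c : ℂ}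
    {r : ℝ} (hg : ConvexOn ℝ univ g) (hg_cont : Continuous g)
    (hf : ContinuousOn f (Metric.sphere c |r|)) :
    g (Real.circleAverage f c r) ≤ Real.circleAverage (g ∘ f) c r := by
  have h_vol : volume (uIoc 0 (2 * Real.pi)) = ENNReal.ofReal (2 * Real.pi) := by
    rw [uIoc_of_le Real.two_pi_pos.le, Real.volume_Ioc, sub_zero]
  rw [Real.circleAverage_eq_intervalAverage, Real.circleAverage_eq_intervalAverage]
  refine hg.map_set_average_le hg_cont.continuousOn isClosed_univ ?_ ?_
    (Eventually.of_forall fun _ => mem_univ _) ?_ ?_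
  · simpa [h_vol] using Real.pi_pos
  · exact h_vol ▸ ENNReal.ofReal_ne_top
  · exact hf.circleIntegrable'.def'
  · exact (hg_cont.comp_continuousOn hf).circleIntegrable'.def'

variable [NormedSpace ℂ E] [CompleteSpace E] {F : ℂ → E} {g : ℝ → ℝ} {c : ℂ} {r R : ℝ}

lemma apply_norm_le_circleAverage (hg_conv : ConvexOn ℝ (Ici 0) g) (hg_mono : MonotoneOn g (Ici 0))
    (hg_cont : ContinuousOn g (Ici 0)) (hF : DifferentiableOn ℂ F (Metric.closedBall c |r|)) :
    g ‖F c‖ ≤ Real.circleAverage (fun z => g ‖F z‖) c r := by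
  have h_mean : Real.circleAverage F c r = F c := DiffContOnCl.circleAverage
    (hF.mono Metric.closure_ball_subset_closedBall).diffContOnCl
  have h_conv : ConvexOn ℝ univ fun v : E => g ‖v‖ := by
    refine ⟨convex_univ, fun v _ w _ a b ha hb hab => ?_⟩
    calc g ‖a • v + b • w‖ ≤ g (a • ‖v‖ + b • ‖w‖) := by
          refine hg_mono (norm_nonneg _) (mem_Ici.2 (by positivity)) ((norm_add_le _ _).trans_eq ?_)
          simp only [norm_smul, Real.norm_of_nonneg, ha, hb, smul_eq_mul]
      _ ≤ a • g ‖v‖ + b • g ‖w‖ := hg_conv.2 (norm_nonneg v) (norm_nonneg w) ha hb hab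
  have h_cont : Continuous fun v : E => g ‖v‖ :=
    hg_cont.comp_continuous continuous_norm fun v => norm_nonneg v
  have h_jensen := map_circleAverage_le h_conv h_cont
    (hF.continuousOn.mono Metric.sphere_subset_closedBall)
  rwa [h_mean] at h_jensen

lemma ofReal_two_pi_mul_circleAverage {u : ℂ → ℝ} (hu : CircleIntegrable u c r)
    (hu_nonneg : ∀ z, 0 ≤ u z) :
    ENNReal.ofReal (2 * Real.pi * Real.circleAverage u c r) =
      ∫⁻ θ in Ioo (-Real.pi) Real.pi, ENNReal.ofReal (u (circleMap c r θ)) := by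
  have h_le : -Real.pi ≤ Real.pi := by linarith [Real.pi_pos]
  have h_int : IntervalIntegrable (fun θ => u (circleMap c r θ)) volume (-Real.pi) Real.pi := by
    have h_per : Function.Periodic (fun θ => u (circleMap c r θ)) (2 * Real.pi) := fun θ => by
      simp only [periodic_circleMap c r θ]
    exact h_per.intervalIntegrable₀ Real.two_pi_pos.ne' hu _ _
  have h_avg : 2 * Real.pi * Real.circleAverage u c r =
      ∫ θ in -Real.pi..Real.pi, u (circleMap c r θ) := by
    rw [Real.circleAverage_eq_integral_add (-Real.pi), smul_eq_mul,
      mul_inv_cancel_left₀ Real.two_pi_pos.ne',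
      intervalIntegral.integral_comp_add_right fun θ => u (circleMap c r θ)]
    ring_nf
  rw [h_avg, intervalIntegral.integral_of_le h_le, integral_Ioc_eq_integral_Ioo,
    ofReal_integral_eq_lintegral_ofReal
      ((intervalIntegrable_iff_integrableOn_Ioo_of_le h_le).1 h_int)
      (Eventually.of_forall fun θ => hu_nonneg _)]

lemma lintegral_ball_eq_lintegral_circleMap {h : ℂ → ENNReal} (hh : Measurable h) :
    ∫⁻ z in Metric.ball c R, h z =
      ∫⁻ r in Ioo 0 R, ENNReal.ofReal r * ∫⁻ θ in Ioo (-Real.pi) Real.pi, h (circleMap c r θ) := by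
  have h_symm : ∀ p : ℝ × ℝ, c + Complex.polarCoord.symm p = circleMap c p.1 p.2 := fun p => by
    rw [Complex.polarCoord_symm_apply, circleMap, Complex.exp_mul_I]
    push_cast
    ring
  have h_ind : ∀ r ∈ Ioi (0 : ℝ),
      ∫⁻ θ in Ioo (-Real.pi) Real.pi, ENNReal.ofReal r •
        (Metric.ball c R).indicator h (circleMap c r θ) =
      (Iio R).indicator (fun r => ENNReal.ofReal r *
        ∫⁻ θ in Ioo (-Real.pi) Real.pi, h (circleMap c r θ)) r := fun r hr => by
    have h_mem : ∀ θ, circleMap c r θ ∈ Metric.ball c R ↔ r ∈ Iio R := fun θ => by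
      rw [Metric.mem_ball, Metric.mem_sphere.1 (circleMap_mem_sphere c (le_of_lt hr) θ), mem_Iio]
    by_cases hrR : r ∈ Iio R
    · simp only [indicator_of_mem, h_mem, hrR, smul_eq_mul]
      exact lintegral_const_mul' _ _ ENNReal.ofReal_ne_top
    · simp only [indicator_of_notMem, h_mem, hrR, not_false_eq_true, smul_zero, lintegral_zero]
  rw [← lintegral_indicator measurableSet_ball,
    ← lintegral_add_left_eq_self ((Metric.ball c R).indicator h) c,
    ← Complex.lintegral_comp_polarCoord_symm]
  simp only [h_symm, polarCoord_target]
  rw [Measure.volume_eq_prod, ← Measure.prod_restrict, lintegral_prod,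
    setLIntegral_congr_fun measurableSet_Ioi h_ind, lintegral_indicator measurableSet_Iio,
    Measure.restrict_restrict measurableSet_Iio, inter_comm, Ioi_inter_Iio]
  refine Measurable.aemeasurable ?_
  refine (ENNReal.measurable_ofReal.comp measurable_fst).mul
    ((hh.indicator measurableSet_ball).comp ?_)
  unfold circleMap
  fun_prop

lemma setLIntegral_Ioo_ofReal (hR : 0 ≤ R) :
    ∫⁻ r in Ioo 0 R, ENNReal.ofReal r = ENNReal.ofReal (R ^ 2 / 2) := by
  rw [← ofReal_integral_eq_lintegral_ofReal, ← integral_Ioc_eq_integral_Ioo,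
    ← intervalIntegral.integral_of_le hR, integral_id, zero_pow two_ne_zero, sub_zero]
  · exact continuous_id.integrableOn_Icc.mono_set Ioo_subset_Icc_self
  · exact (ae_restrict_mem measurableSet_Ioo).mono fun r hr => hr.1.le

theorem ofReal_mul_apply_norm_le_lintegral_ball (hg_conv : ConvexOn ℝ (Ici 0) g)
    (hg_mono : MonotoneOn g (Ici 0)) (hg_cont : ContinuousOn g (Ici 0))
    (hg_nonneg : ∀ x, 0 ≤ x → 0 ≤ g x) (hR : 0 ≤ R)
    (hF : DifferentiableOn ℂ F (Metric.ball c R)) :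
    ENNReal.ofReal (Real.pi * R ^ 2 * g ‖F c‖) ≤
      ∫⁻ z in Metric.ball c R, ENNReal.ofReal (g ‖F z‖) := by
  classical
  have h_cont : ContinuousOn (fun z => ENNReal.ofReal (g ‖F z‖)) (Metric.ball c R) :=
    ENNReal.continuous_ofReal.comp_continuousOn
      (hg_cont.comp hF.continuousOn.norm fun z _ => norm_nonneg (F z))
  set h := (Metric.ball c R).piecewise (fun z => ENNReal.ofReal (g ‖F z‖)) 0 with h_def
  have h_meas : Measurable h :=
    h_cont.measurable_piecewise continuousOn_const measurableSet_ball
  have h_circle : ∀ r ∈ Ioo 0 R, ENNReal.ofReal (2 * Real.pi * g ‖F c‖) ≤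
      ∫⁻ θ in Ioo (-Real.pi) Real.pi, h (circleMap c r θ) := fun r hr => by
    have h_sub : Metric.closedBall c |r| ⊆ Metric.ball c R := by
      rw [abs_of_pos hr.1]
      exact Metric.closedBall_subset_ball hr.2
    have h_sphere : ∀ θ, circleMap c r θ ∈ Metric.ball c R := fun θ =>
      h_sub (Metric.sphere_subset_closedBall (circleMap_mem_sphere' c r θ))
    have h_circ_int : CircleIntegrable (fun z => g ‖F z‖) c r :=
      ((hg_cont.comp hF.continuousOn.norm fun z _ => norm_nonneg (F z)).mono
        (Metric.sphere_subset_closedBall.trans h_sub)).circleIntegrable'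
    simp only [h_def, piecewise_eq_of_mem _ _ _ (h_sphere _)]
    rw [← ofReal_two_pi_mul_circleAverage h_circ_int fun z => hg_nonneg _ (norm_nonneg _)]
    gcongr
    exact apply_norm_le_circleAverage hg_conv hg_mono hg_cont (hF.mono h_sub)
  calc ENNReal.ofReal (Real.pi * R ^ 2 * g ‖F c‖)
      = ∫⁻ r in Ioo 0 R, ENNReal.ofReal r * ENNReal.ofReal (2 * Real.pi * g ‖F c‖) := by
        rw [lintegral_mul_const _ ENNReal.measurable_ofReal, setLIntegral_Ioo_ofReal hR,
          ← ENNReal.ofReal_mul (by positivity)]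
        ring_nf
    _ ≤ ∫⁻ r in Ioo 0 R, ENNReal.ofReal r *
          ∫⁻ θ in Ioo (-Real.pi) Real.pi, h (circleMap c r θ) :=
        setLIntegral_mono' measurableSet_Ioo fun r hr => by gcongr; exact h_circle r hr
    _ = ∫⁻ z in Metric.ball c R, h z := (lintegral_ball_eq_lintegral_circleMap h_meas).symm
    _ = ∫⁻ z in Metric.ball c R, ENNReal.ofReal (g ‖F z‖) :=
        setLIntegral_congr_fun measurableSet_ball fun z hz => piecewise_eq_of_mem _ _ _ hz

end MeanValue

namespace Disk

lemma norm_lt_one (z : Disk) : ‖(z : ℂ)‖ < 1 := mem_ball_zero_iff.1 z.2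

lemma one_sub_norm_pos (z : Disk) : 0 < 1 - ‖(z : ℂ)‖ := sub_pos.2 z.norm_lt_one

lemma one_sub_norm_le_one (z : Disk) : 1 - ‖(z : ℂ)‖ ≤ 1 := sub_le_self _ (norm_nonneg _)

lemma isCompact_norm_le {ρ : ℝ} (hρ : ρ < 1) : IsCompact {z : Disk | ‖(z : ℂ)‖ ≤ ρ} := by
  have h_ball : {z : Disk | ‖(z : ℂ)‖ ≤ ρ} = Subtype.val ⁻¹' Metric.closedBall (0 : ℂ) ρ := by
    ext z
    exact mem_closedBall_zero_iff.symm
  rw [h_ball]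
  refine IsInducing.subtypeVal.isCompact_preimage' (isCompact_closedBall _ _) ?_
  rw [Subtype.range_coe]
  exact Metric.closedBall_subset_ball hρ

lemma comap_norm_eq_cocompact : comap (fun z : Disk => ‖(z : ℂ)‖) (𝓝[<] 1) = cocompact Disk := by
  refine le_antisymm ?_ (tendsto_iff_comap.1 (tendsto_nhdsWithin_iff.2
    ⟨tendsto_order.2 ⟨fun ρ hρ => ?_, fun ρ hρ => ?_⟩, Eventually.of_forall norm_lt_one⟩))
  · refine (hasBasis_cocompact.ge_iff).2 fun K hK => ?_
    have h_closed := (hK.image (continuous_norm.comp continuous_subtype_val)).isClosed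
    refine mem_comap.2 ⟨_, nhdsWithin_le_nhds (h_closed.compl_mem_nhds ?_),
      fun z hz hzK => hz ⟨z, hzK, rfl⟩⟩
    rintro ⟨z, -, hz⟩
    exact z.norm_lt_one.ne hz
  · filter_upwards [(isCompact_norm_le hρ).compl_mem_cocompact] with z hz using not_le.1 hz
  · exact Eventually.of_forall fun z => z.norm_lt_one.trans hρ

lemma tendsto_one_sub_norm : Tendsto (fun z : Disk => 1 - ‖(z : ℂ)‖) (cocompact Disk) (𝓝[>] 0) := by
  refine tendsto_nhdsWithin_iff.2 ⟨?_, Eventually.of_forall one_sub_norm_pos⟩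
  have h : Tendsto (fun z : Disk => ‖(z : ℂ)‖) (cocompact Disk) (𝓝 1) :=
    (tendsto_iff_comap.2 comap_norm_eq_cocompact.ge).mono_right nhdsWithin_le_nhds
  simpa only [sub_self] using h.const_sub 1

lemma lintegral_area (h : ℂ → ENNReal) :
    ∫⁻ z : Disk, h z ∂area =
      (ENNReal.ofReal Real.pi)⁻¹ * ∫⁻ z in Metric.ball (0 : ℂ) 1, h z := by
  rw [area, lintegral_smul_measure, smul_eq_mul, lintegral_subtype_comap measurableSet_ball]

lemma inv_ofReal_pi_mul_volume_ball :
    (ENNReal.ofReal Real.pi)⁻¹ * volume (Metric.ball (0 : ℂ) 1) = 1 := by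
  rw [Complex.volume_ball, ENNReal.ofReal_one, one_pow, one_mul, ← NNReal.coe_real_pi,
    ENNReal.ofReal_coe_nnreal, ENNReal.inv_mul_cancel] <;> simp [NNReal.pi_ne_zero]

instance : IsProbabilityMeasure area where
  measure_univ := by
    rw [← lintegral_one, lintegral_area fun _ => 1, setLIntegral_one, inv_ofReal_pi_mul_volume_ball]

end Disk

namespace OrliczFunction

/-- The growth bound `Ψ⁻¹(1 / (1 - |z|)²)` of the unit ball of `𝓑^Ψ`; condition (*) compares its
values at `φ(a)` and at `a`. -/
noncomputable def growthBound (Ψ : OrliczFunction) (z : Disk) : ℝ :=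
  Ψ.inv (1 / (1 - ‖(z : ℂ)‖) ^ 2)

variable (Ψ : OrliczFunction)

lemma growthBound_pos (z : Disk) : 0 < Ψ.growthBound z :=
  inv_pos (one_div_pos.2 (pow_pos z.one_sub_norm_pos 2))

lemma apply_growthBound (z : Disk) : Ψ (Ψ.growthBound z) = 1 / (1 - ‖(z : ℂ)‖) ^ 2 :=
  apply_inv (by positivity)

lemma inv_one_le_growthBound (z : Disk) : Ψ.inv 1 ≤ Ψ.growthBound z :=
  monotoneOn_inv (mem_Ici.2 zero_le_one) (mem_Ici.2 (by positivity))
    ((one_le_div (pow_pos z.one_sub_norm_pos 2)).2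
      (pow_le_one₀ z.one_sub_norm_pos.le z.one_sub_norm_le_one))

lemma exists_growthBound_le_of_isCompact {K : Set Disk} (hK : IsCompact K) :
    ∃ B, ∀ z ∈ K, Ψ.growthBound z ≤ B := by
  have h_cont : Continuous fun z : Disk => 1 / (1 - ‖(z : ℂ)‖) ^ 2 :=
    continuous_const.div (by fun_prop) fun z => (pow_pos z.one_sub_norm_pos 2).ne'
  obtain ⟨b, hb⟩ := (hK.image h_cont).bddAbove
  exact ⟨Ψ.inv b, fun z hz =>
    monotoneOn_inv (mem_Ici.2 (by positivity))
      (mem_Ici.2 (le_trans (by positivity) (hb (mem_image_of_mem _ hz))))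
      (hb (mem_image_of_mem _ hz))⟩

lemma tendsto_growthBound : Tendsto Ψ.growthBound (cocompact Disk) atTop := by
  refine tendsto_inv_atTop.comp ?_
  simp only [one_div, ← inv_pow]
  exact (tendsto_pow_atTop two_ne_zero).comp Disk.tendsto_one_sub_norm.inv_tendsto_nhdsGT_zero

end OrliczFunction

section PointEvaluation

variable {Ψ : OrliczFunction} {f : Disk → ℂ} {C : ℝ}

lemma ofReal_mul_apply_norm_le_orliczModular (hf : Disk.Analytic f) (hC : 0 < C) (a : Disk) :
    ENNReal.ofReal ((1 - ‖(a : ℂ)‖) ^ 2 * Ψ (‖f a‖ / C)) ≤ orliczModular Ψ f C := by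
  obtain ⟨F, hF, hfF⟩ := hf
  have h_sub : Metric.ball (a : ℂ) (1 - ‖(a : ℂ)‖) ⊆ Metric.ball 0 1 :=
    Metric.ball_subset_ball' (by simp)
  have h_norm : ∀ z, ‖F z / C‖ = ‖F z‖ / C := fun z => by
    rw [norm_div, Complex.norm_of_nonneg hC.le]
  have h_mean := ofReal_mul_apply_norm_le_lintegral_ball Ψ.convexOn Ψ.monotoneOn' Ψ.continuousOn
    (fun _ => Ψ.nonneg) a.one_sub_norm_pos.le ((hF.mono h_sub).div_const (C : ℂ))
  simp only [h_norm] at h_mean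
  have h_pi : ENNReal.ofReal Real.pi ≠ 0 := by simpa using Real.pi_pos
  simp only [orliczModular, hfF]
  rw [Disk.lintegral_area fun z => ENNReal.ofReal (Ψ (‖F z‖ / C)), mul_comm _⁻¹,
    ← div_eq_mul_inv, ENNReal.le_div_iff_mul_le (.inl h_pi) (.inl ENNReal.ofReal_ne_top),
    mul_comm, ← ENNReal.ofReal_mul Real.pi_pos.le, ← mul_assoc]
  exact h_mean.trans (lintegral_mono_set h_sub)

lemma norm_apply_le_mul_growthBound (hf : Disk.Analytic f) (hC : 0 < C)
    (h : orliczModular Ψ f C ≤ 1) (a : Disk) : ‖f a‖ ≤ C * Ψ.growthBound a := by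
  have h_le := (ofReal_mul_apply_norm_le_orliczModular hf hC a).trans h
  have ha : 0 < (1 - ‖(a : ℂ)‖) ^ 2 := pow_pos a.one_sub_norm_pos 2
  rw [ENNReal.ofReal_le_one, ← le_div_iff₀' ha] at h_le
  rwa [← div_le_iff₀' hC, OrliczFunction.growthBound,
    OrliczFunction.le_inv_iff (by positivity) (by positivity)]

end PointEvaluation

namespace BergmanOrlicz

variable {Ψ : OrliczFunction}

lemma norm_le_of_orliczModular_le_one (f : BergmanOrlicz Ψ) {C : ℝ} (hC : 0 < C)
    (h : orliczModular Ψ f C ≤ 1) : ‖f‖ ≤ C :=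
  csInf_le (luxemburgNorm_bddBelow Ψ _) ⟨hC, h⟩

lemma norm_apply_le (f : BergmanOrlicz Ψ) (a : Disk) : ‖f a‖ ≤ ‖f‖ * Ψ.growthBound a := by
  rw [← div_le_iff₀ (Ψ.growthBound_pos a)]
  exact le_csInf f.nonempty_set fun C hC =>
    (div_le_iff₀ (Ψ.growthBound_pos a)).2 (norm_apply_le_mul_growthBound f.2.1 hC.1 hC.2 a)

lemma continuous_coe : Continuous fun f : BergmanOrlicz Ψ => (f : Disk → ℂ) := by
  refine continuous_pi fun a => ?_
  let eval : BergmanOrlicz Ψ →ₗ[ℂ] ℂ :=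
    { toFun := fun f => f a, map_add' := fun _ _ => rfl, map_smul' := fun _ _ => rfl }
  exact (eval.mkContinuous (Ψ.growthBound a) fun f =>
    (f.norm_apply_le a).trans_eq (mul_comm _ _)).continuous

end BergmanOrlicz

section GrowthRatio

variable {Ψ : OrliczFunction} {φ : Disk → Disk}

lemma bergmanCompactCondition_iff_tendsto_cocompact : BergmanCompactCondition Ψ φ ↔
    Tendsto (fun a => Ψ.growthBound (φ a) / Ψ.growthBound a) (cocompact Disk) (𝓝 0) := by
  rw [BergmanCompactCondition, Disk.comap_norm_eq_cocompact]
  rfl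

lemma BergmanCompactCondition.tendsto_comap (h : BergmanCompactCondition Ψ φ)
    (hφ : Continuous φ) :
    Tendsto (fun a => Ψ.growthBound (φ a) / Ψ.growthBound a) (comap φ (cocompact Disk)) (𝓝 0) :=
  (bergmanCompactCondition_iff_tendsto_cocompact.1 h).mono_left (comap_cocompact_le hφ)

lemma bergmanCompactCondition_of_tendsto_comap
    (h : Tendsto (fun a => Ψ.growthBound (φ a) / Ψ.growthBound a) (comap φ (cocompact Disk))
      (𝓝 0)) :
    BergmanCompactCondition Ψ φ := by
  refine bergmanCompactCondition_iff_tendsto_cocompact.2 (tendsto_order.2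
    ⟨fun ε hε => Eventually.of_forall fun a =>
      hε.trans (div_pos (Ψ.growthBound_pos _) (Ψ.growthBound_pos a)), fun ε hε => ?_⟩)
  obtain ⟨K, hK, hKε⟩ :=
    ((hasBasis_cocompact.comap φ).eventually_iff).1 (h.eventually_lt_const hε)
  obtain ⟨B, hB⟩ := Ψ.exists_growthBound_le_of_isCompact hK
  filter_upwards [Ψ.tendsto_growthBound.eventually_gt_atTop (B / ε)] with a ha
  by_cases haK : φ a ∈ K
  · rw [div_lt_iff₀ (Ψ.growthBound_pos a)]
    exact (hB _ haK).trans_lt ((div_lt_iff₀' hε).1 ha)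
  · exact hKε haK

lemma BergmanCompactCondition.exists_growthBound_comp_le (h : BergmanCompactCondition Ψ φ)
    (hφ : Continuous φ) : ∃ M, ∀ a, Ψ.growthBound (φ a) ≤ M * Ψ.growthBound a := by
  obtain ⟨K, hK, hK_lt⟩ := hasBasis_cocompact.eventually_iff.1
    ((bergmanCompactCondition_iff_tendsto_cocompact.1 h).eventually_lt_const zero_lt_one)
  obtain ⟨B, hB⟩ := Ψ.exists_growthBound_le_of_isCompact (hK.image hφ)
  have h_one : 0 < Ψ.inv 1 := OrliczFunction.inv_pos one_pos
  refine ⟨max 1 (B / Ψ.inv 1), fun a => (div_le_iff₀ (Ψ.growthBound_pos a)).1 ?_⟩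
  by_cases ha : a ∈ K
  · have hBa := hB _ (mem_image_of_mem φ ha)
    refine le_max_of_le_right (div_le_div₀ ((Ψ.growthBound_pos _).le.trans hBa) hBa h_one
      (Ψ.inv_one_le_growthBound a))
  · exact le_max_of_le_left (hK_lt ha).le

end GrowthRatio

section DiskAutomorphism

open scoped ComplexConjugate

lemma lintegral_norm_sq_deriv_eq_volume_image {s : Set ℂ} {f f' : ℂ → ℂ} (hs : MeasurableSet s)
    (hf' : ∀ z ∈ s, HasDerivWithinAt f (f' z) s z) (hf : InjOn f s) :
    ∫⁻ z in s, ENNReal.ofReal (‖f' z‖ ^ 2) = volume (f '' s) := by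
  rw [← lintegral_abs_det_fderiv_eq_addHaar_image volume hs
    (fun z hz => (hf' z hz).hasFDerivWithinAt.restrictScalars ℝ) hf]
  refine lintegral_congr fun z => congrArg ENNReal.ofReal ?_
  simp [ContinuousLinearMap.det, LinearMap.det_restrictScalars, Algebra.norm_complex_eq,
    Complex.normSq_eq_norm_sq]

lemma normSq_one_sub_conj_mul_sub_normSq_sub (b z : ℂ) :
    Complex.normSq (1 - conj b * z) - Complex.normSq (z - b)
      = (1 - Complex.normSq b) * (1 - Complex.normSq z) := by
  simp only [Complex.normSq_apply, Complex.sub_re, Complex.sub_im, Complex.mul_re, Complex.mul_im,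
    Complex.conj_re, Complex.conj_im, Complex.one_re, Complex.one_im]
  ring

lemma norm_one_sub_conj_mul_self {b : ℂ} (hb : ‖b‖ ≤ 1) : ‖1 - conj b * b‖ = 1 - ‖b‖ ^ 2 := by
  rw [Complex.conj_mul', ← Complex.ofReal_pow, ← Complex.ofReal_one, ← Complex.ofReal_sub,
    Complex.norm_of_nonneg (sub_nonneg.2 (pow_le_one₀ (norm_nonneg b) hb))]

lemma one_sub_mul_norm_le_norm_one_sub_conj_mul (b z : ℂ) :
    1 - ‖b‖ * ‖z‖ ≤ ‖1 - conj b * z‖ := by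
  simpa only [norm_one, norm_mul, RCLike.norm_conj] using norm_sub_norm_le (1 : ℂ) (conj b * z)

namespace Disk

lemma one_sub_norm_le_norm_one_sub_conj_mul_left (b z : Disk) :
    1 - ‖(b : ℂ)‖ ≤ ‖1 - conj (b : ℂ) * z‖ :=
  (sub_le_sub_left (mul_le_of_le_one_right (norm_nonneg _) z.norm_lt_one.le) 1).trans
    (one_sub_mul_norm_le_norm_one_sub_conj_mul _ _)

lemma one_sub_norm_le_norm_one_sub_conj_mul_right (b z : Disk) :
    1 - ‖(z : ℂ)‖ ≤ ‖1 - conj (b : ℂ) * z‖ :=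
  (sub_le_sub_left (mul_le_of_le_one_left (norm_nonneg _) b.norm_lt_one.le) 1).trans
    (one_sub_mul_norm_le_norm_one_sub_conj_mul _ _)

lemma one_sub_conj_mul_ne_zero (b z : Disk) : 1 - conj (b : ℂ) * z ≠ 0 :=
  norm_pos_iff.1 (b.one_sub_norm_pos.trans_le (one_sub_norm_le_norm_one_sub_conj_mul_left b z))

/-- The Möbius transformation `z ↦ (z - b) / (1 - b̄ z)`, which maps the disk into itself and `b`
to `0`. -/
noncomputable def mobius (b : Disk) (z : ℂ) : ℂ := (z - b) / (1 - conj (b : ℂ) * z)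

lemma hasDerivAt_mobius (b z : Disk) :
    HasDerivAt b.mobius ((1 - conj (b : ℂ) * b) / (1 - conj (b : ℂ) * z) ^ 2) z := by
  refine (((hasDerivAt_id (z : ℂ)).sub_const (b : ℂ)).fun_div
    (((hasDerivAt_id (z : ℂ)).const_mul (conj (b : ℂ))).const_sub 1)
    (one_sub_conj_mul_ne_zero b z)).congr_deriv ?_
  simp only [id]
  ring

lemma injOn_mobius (b : Disk) : InjOn b.mobius (Metric.ball 0 1) := fun z hz w hw hzw => by
  rw [mobius, mobius, div_eq_div_iff (one_sub_conj_mul_ne_zero b ⟨z, hz⟩)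
    (one_sub_conj_mul_ne_zero b ⟨w, hw⟩)] at hzw
  have h_mul : (1 - conj (b : ℂ) * b) * (z - w) = 0 := by linear_combination hzw
  exact sub_eq_zero.1 ((mul_eq_zero.1 h_mul).resolve_left (one_sub_conj_mul_ne_zero b b))

lemma norm_mobius_lt_one (b z : Disk) : ‖b.mobius z‖ < 1 := by
  have h_identity := normSq_one_sub_conj_mul_sub_normSq_sub b z
  simp only [Complex.normSq_eq_norm_sq] at h_identity
  have h_pos : 0 < (1 - ‖(b : ℂ)‖ ^ 2) * (1 - ‖(z : ℂ)‖ ^ 2) :=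
    mul_pos (sub_pos.2 (pow_lt_one₀ (norm_nonneg _) b.norm_lt_one two_ne_zero))
      (sub_pos.2 (pow_lt_one₀ (norm_nonneg _) z.norm_lt_one two_ne_zero))
  rw [mobius, norm_div, div_lt_one (norm_pos_iff.2 (one_sub_conj_mul_ne_zero b z))]
  exact lt_of_pow_lt_pow_left₀ 2 (norm_nonneg _) (by linarith)

lemma lintegral_norm_sq_deriv_mobius_le (b : Disk) :
    ∫⁻ z : Disk, ENNReal.ofReal (‖(1 - conj (b : ℂ) * b) / (1 - conj (b : ℂ) * z) ^ 2‖ ^ 2) ∂area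
      ≤ 1 := by
  rw [lintegral_area fun z =>
      ENNReal.ofReal (‖(1 - conj (b : ℂ) * b) / (1 - conj (b : ℂ) * z) ^ 2‖ ^ 2),
    lintegral_norm_sq_deriv_eq_volume_image measurableSet_ball
      (fun z hz => (hasDerivAt_mobius b ⟨z, hz⟩).hasDerivWithinAt) b.injOn_mobius,
    ← inv_ofReal_pi_mul_volume_ball]
  gcongr
  exact image_subset_iff.2 fun z hz => mem_ball_zero_iff.2 (norm_mobius_lt_one b ⟨z, hz⟩)

end Disk

/-- The bounded analytic function `((1 - |b|) / (1 - b̄ z))⁴`, which peaks at `b` and whose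
`L¹`-norm is of order `(1 - |b|)²`. The exponent is twice the `2` of the reproducing kernel, so
that up to a constant it is a squared derivative of `Disk.mobius b`. -/
noncomputable def bergmanPeak (b z : Disk) : ℂ :=
  ((1 - ‖(b : ℂ)‖ : ℝ) / (1 - conj (b : ℂ) * z)) ^ 4

lemma norm_bergmanPeak (b z : Disk) :
    ‖bergmanPeak b z‖ = ((1 - ‖(b : ℂ)‖) / ‖1 - conj (b : ℂ) * z‖) ^ 4 := by
  rw [bergmanPeak, norm_pow, norm_div, Complex.norm_of_nonneg b.one_sub_norm_pos.le]

lemma norm_bergmanPeak_le_one (b z : Disk) : ‖bergmanPeak b z‖ ≤ 1 := by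
  rw [norm_bergmanPeak]
  exact pow_le_one₀ (div_nonneg b.one_sub_norm_pos.le (norm_nonneg _))
    (div_le_one_of_le₀ (Disk.one_sub_norm_le_norm_one_sub_conj_mul_left b z) (norm_nonneg _))

lemma norm_bergmanPeak_le_div_pow (b z : Disk) :
    ‖bergmanPeak b z‖ ≤ ((1 - ‖(b : ℂ)‖) / (1 - ‖(z : ℂ)‖)) ^ 4 := by
  have hb := b.one_sub_norm_pos.le
  have hz := z.one_sub_norm_pos
  rw [norm_bergmanPeak]
  gcongr
  exact Disk.one_sub_norm_le_norm_one_sub_conj_mul_right b z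

lemma one_div_sixteen_le_norm_bergmanPeak_self (b : Disk) : 1 / 16 ≤ ‖bergmanPeak b b‖ := by
  have hb := b.one_sub_norm_pos
  have h_half : (1 : ℝ) / 2 ≤ 1 / (1 + ‖(b : ℂ)‖) :=
    one_div_le_one_div_of_le (by positivity) (by linarith)
  have h_factor : 1 - ‖(b : ℂ)‖ ^ 2 = (1 - ‖(b : ℂ)‖) * (1 + ‖(b : ℂ)‖) := by ring
  rw [norm_bergmanPeak, norm_one_sub_conj_mul_self b.norm_lt_one.le, h_factor,
    div_mul_eq_div_div, div_self hb.ne']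
  exact le_trans (by norm_num) (pow_le_pow_left₀ (by positivity) h_half 4)

lemma analytic_bergmanPeak (b : Disk) : Disk.Analytic (bergmanPeak b) := by
  refine ⟨fun z => ((1 - ‖(b : ℂ)‖ : ℝ) / (1 - conj (b : ℂ) * z)) ^ 4, ?_, fun z => rfl⟩
  exact ((differentiableOn_const _).div (by fun_prop) fun z hz =>
    Disk.one_sub_conj_mul_ne_zero b ⟨z, hz⟩).pow 4

lemma norm_bergmanPeak_le_norm_sq_deriv_mobius (b z : Disk) :
    ‖bergmanPeak b z‖ ≤ (1 - ‖(b : ℂ)‖) ^ 2 *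
      ‖(1 - conj (b : ℂ) * b) / (1 - conj (b : ℂ) * z) ^ 2‖ ^ 2 := by
  have hb := b.one_sub_norm_pos.le
  have h_le : 1 - ‖(b : ℂ)‖ ≤ 1 - ‖(b : ℂ)‖ ^ 2 :=
    sub_le_sub_left (pow_le_of_le_one (norm_nonneg _) b.norm_lt_one.le two_ne_zero) 1
  rw [norm_bergmanPeak, norm_div, norm_one_sub_conj_mul_self b.norm_lt_one.le, norm_pow, div_pow,
    div_pow, ← pow_mul, ← mul_div_assoc]
  calc (1 - ‖(b : ℂ)‖) ^ 4 / ‖1 - conj (b : ℂ) * z‖ ^ 4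
      = (1 - ‖(b : ℂ)‖) ^ 2 * (1 - ‖(b : ℂ)‖) ^ 2 / ‖1 - conj (b : ℂ) * z‖ ^ (2 * 2) := by ring
    _ ≤ _ := by gcongr

lemma lintegral_norm_bergmanPeak_le (b : Disk) :
    ∫⁻ z, ENNReal.ofReal ‖bergmanPeak b z‖ ∂Disk.area ≤ ENNReal.ofReal ((1 - ‖(b : ℂ)‖) ^ 2) := by
  calc ∫⁻ z, ENNReal.ofReal ‖bergmanPeak b z‖ ∂Disk.area
      ≤ ∫⁻ z : Disk, ENNReal.ofReal ((1 - ‖(b : ℂ)‖) ^ 2) * ENNReal.ofReal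
          (‖(1 - conj (b : ℂ) * b) / (1 - conj (b : ℂ) * z) ^ 2‖ ^ 2) ∂Disk.area :=
        lintegral_mono fun z => by
          rw [← ENNReal.ofReal_mul (by positivity)]
          exact ENNReal.ofReal_le_ofReal (norm_bergmanPeak_le_norm_sq_deriv_mobius b z)
    _ = ENNReal.ofReal ((1 - ‖(b : ℂ)‖) ^ 2) * ∫⁻ z : Disk, ENNReal.ofReal
          (‖(1 - conj (b : ℂ) * b) / (1 - conj (b : ℂ) * z) ^ 2‖ ^ 2) ∂Disk.area :=
        lintegral_const_mul' _ _ ENNReal.ofReal_ne_top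
    _ ≤ ENNReal.ofReal ((1 - ‖(b : ℂ)‖) ^ 2) :=
        mul_le_of_le_one_right zero_le b.lintegral_norm_sq_deriv_mobius_le

end DiskAutomorphism

namespace BergmanOrlicz

variable (Ψ : OrliczFunction)

lemma orliczModular_growthBound_smul_bergmanPeak_le_one (b : Disk) :
    orliczModular Ψ ((Ψ.growthBound b : ℂ) • bergmanPeak b) 1 ≤ 1 := by
  have h_point : ∀ z, Ψ (‖((Ψ.growthBound b : ℂ) • bergmanPeak b) z‖ / 1) ≤
      1 / (1 - ‖(b : ℂ)‖) ^ 2 * ‖bergmanPeak b z‖ := fun z => by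
    rw [div_one, Pi.smul_apply, norm_smul, Complex.norm_of_nonneg (Ψ.growthBound_pos b).le,
      ← Ψ.apply_growthBound, mul_comm, mul_comm (Ψ _)]
    exact Ψ.le_mul (Ψ.growthBound_pos b).le (norm_nonneg _) (norm_bergmanPeak_le_one b z)
  have hb : 0 < (1 - ‖(b : ℂ)‖) ^ 2 := pow_pos b.one_sub_norm_pos 2
  calc orliczModular Ψ ((Ψ.growthBound b : ℂ) • bergmanPeak b) 1
      ≤ ∫⁻ z, ENNReal.ofReal (1 / (1 - ‖(b : ℂ)‖) ^ 2) *
          ENNReal.ofReal ‖bergmanPeak b z‖ ∂Disk.area :=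
        lintegral_mono fun z => by
          rw [← ENNReal.ofReal_mul (by positivity)]
          exact ENNReal.ofReal_le_ofReal (h_point z)
    _ = ENNReal.ofReal (1 / (1 - ‖(b : ℂ)‖) ^ 2) *
          ∫⁻ z, ENNReal.ofReal ‖bergmanPeak b z‖ ∂Disk.area :=
        lintegral_const_mul' _ _ ENNReal.ofReal_ne_top
    _ ≤ ENNReal.ofReal (1 / (1 - ‖(b : ℂ)‖) ^ 2) * ENNReal.ofReal ((1 - ‖(b : ℂ)‖) ^ 2) := by
        gcongr
        exact lintegral_norm_bergmanPeak_le b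
    _ = 1 := by
        rw [← ENNReal.ofReal_mul (by positivity), one_div_mul_cancel hb.ne', ENNReal.ofReal_one]

/-- The test function of the unit ball of `𝓑^Ψ` that attains the growth bound at `b`, up to a
constant. -/
noncomputable def testFunction (b : Disk) : BergmanOrlicz Ψ :=
  ⟨(Ψ.growthBound b : ℂ) • bergmanPeak b, by
    obtain ⟨F, hF, h⟩ := analytic_bergmanPeak b
    exact ⟨(Ψ.growthBound b : ℂ) • F, hF.const_smul _, fun z => by
      simp only [Pi.smul_apply, h]⟩,
    1, one_pos, (orliczModular_growthBound_smul_bergmanPeak_le_one Ψ b).trans_lt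
      ENNReal.one_lt_top⟩

lemma norm_testFunction_le_one (b : Disk) : ‖testFunction Ψ b‖ ≤ 1 :=
  norm_le_of_orliczModular_le_one _ one_pos (orliczModular_growthBound_smul_bergmanPeak_le_one Ψ b)

lemma norm_testFunction_apply (b z : Disk) :
    ‖testFunction Ψ b z‖ = Ψ.growthBound b * ‖bergmanPeak b z‖ := by
  have h_eq : testFunction Ψ b z = (Ψ.growthBound b : ℂ) * bergmanPeak b z := rfl
  rw [h_eq, norm_mul, Complex.norm_of_nonneg (Ψ.growthBound_pos b).le]

lemma growthBound_le_mul_norm_testFunction_apply_self (b : Disk) :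
    Ψ.growthBound b ≤ 16 * ‖testFunction Ψ b b‖ := by
  have h_peak := mul_le_mul_of_nonneg_left (one_div_sixteen_le_norm_bergmanPeak_self b)
    (Ψ.growthBound_pos b).le
  rw [norm_testFunction_apply]
  linarith

lemma norm_testFunction_apply_le (b z : Disk) :
    ‖testFunction Ψ b z‖ ≤ Ψ.inv 1 / (1 - ‖(z : ℂ)‖) ^ 4 * (1 - ‖(b : ℂ)‖) ^ 2 := by
  have hb := b.one_sub_norm_pos
  have hz := z.one_sub_norm_pos
  have h_inv : Ψ.growthBound b ≤ 1 / (1 - ‖(b : ℂ)‖) ^ 2 * Ψ.inv 1 :=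
    OrliczFunction.inv_le_mul
      ((one_le_div (by positivity)).2 (pow_le_one₀ hb.le b.one_sub_norm_le_one))
  rw [norm_testFunction_apply]
  calc Ψ.growthBound b * ‖bergmanPeak b z‖
      ≤ 1 / (1 - ‖(b : ℂ)‖) ^ 2 * Ψ.inv 1 * ((1 - ‖(b : ℂ)‖) / (1 - ‖(z : ℂ)‖)) ^ 4 :=
        mul_le_mul h_inv (norm_bergmanPeak_le_div_pow b z) (norm_nonneg _)
          ((Ψ.growthBound_pos b).le.trans h_inv)
    _ = Ψ.inv 1 / (1 - ‖(z : ℂ)‖) ^ 4 * (1 - ‖(b : ℂ)‖) ^ 2 := by field_simp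

lemma tendsto_testFunction_apply (z : Disk) :
    Tendsto (fun b => testFunction Ψ b z) (cocompact Disk) (𝓝 0) := by
  have h_zero : Tendsto (fun b : Disk => 1 - ‖(b : ℂ)‖) (cocompact Disk) (𝓝 0) :=
    Disk.tendsto_one_sub_norm.mono_right nhdsWithin_le_nhds
  refine squeeze_zero_norm (fun b => norm_testFunction_apply_le Ψ b z) ?_
  simpa only [zero_pow two_ne_zero, mul_zero] using
    (h_zero.pow 2).const_mul (Ψ.inv 1 / (1 - ‖(z : ℂ)‖) ^ 4)

end BergmanOrlicz

section Necessity

variable {Ψ : OrliczFunction} {φ : Disk → Disk}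

lemma tendsto_of_isCompact_of_tendsto_comp {ι X Y : Type*} [TopologicalSpace X]
    [TopologicalSpace Y] [T2Space Y] {l : Filter ι} {u : ι → X} {e : X → Y} {K : Set X} {x : X}
    (hK : IsCompact K) (hu : ∀ᶠ i in l, u i ∈ K) (he : Continuous e) (he_inj : e.Injective)
    (h : Tendsto (e ∘ u) l (𝓝 (e x))) : Tendsto u l (𝓝 x) := by
  refine hK.tendsto_nhds_of_unique_mapClusterPt hu fun y _ hy => he_inj ?_
  exact eq_of_nhds_neBot ((hy.continuousAt_comp he.continuousAt).clusterPt.mono h)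

lemma tendsto_map_testFunction {T : BergmanOrlicz Ψ →L[ℂ] BergmanOrlicz Ψ}
    (hT : ∀ (f : BergmanOrlicz Ψ) (z : Disk), T f z = f (φ z)) (hT_comp : IsCompactOperator T) :
    Tendsto (fun b => T (BergmanOrlicz.testFunction Ψ b)) (cocompact Disk) (𝓝 0) := by
  obtain ⟨K, hK, hKT⟩ := hT_comp.image_closedBall_subset_compact 1
  refine tendsto_of_isCompact_of_tendsto_comp hK (Eventually.of_forall fun b => hKT
    (mem_image_of_mem T (mem_closedBall_zero_iff.2 (BergmanOrlicz.norm_testFunction_le_one Ψ b))))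
    BergmanOrlicz.continuous_coe Subtype.val_injective (tendsto_pi_nhds.2 fun z => ?_)
  simp only [Function.comp_apply, hT]
  exact BergmanOrlicz.tendsto_testFunction_apply Ψ (φ z)

theorem IsCompactCompositionOperator.bergmanCompactCondition
    (h : IsCompactCompositionOperator Ψ φ) : BergmanCompactCondition Ψ φ := by
  obtain ⟨T, hT, hT_comp⟩ := h
  have h_ratio : ∀ a, Ψ.growthBound (φ a) / Ψ.growthBound a ≤
      16 * ‖T (BergmanOrlicz.testFunction Ψ (φ a))‖ := fun a => by
    rw [div_le_iff₀ (Ψ.growthBound_pos a), mul_assoc]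
    refine (BergmanOrlicz.growthBound_le_mul_norm_testFunction_apply_self Ψ (φ a)).trans ?_
    rw [← hT]
    gcongr
    exact BergmanOrlicz.norm_apply_le _ a
  have h_test : Tendsto (fun a => 16 * ‖T (BergmanOrlicz.testFunction Ψ (φ a))‖)
      (comap φ (cocompact Disk)) (𝓝 0) := by
    simpa only [Function.comp_apply, norm_zero, mul_zero] using
      ((tendsto_map_testFunction hT hT_comp).comp tendsto_comap).norm.const_mul 16
  exact bergmanCompactCondition_of_tendsto_comap (squeeze_zero
    (fun a => (div_pos (Ψ.growthBound_pos _) (Ψ.growthBound_pos a)).le) h_ratio h_test)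

end Necessity

section LocallyUniform

variable {ι : Type*}

lemma tendstoUniformlyOn_of_equicontinuousOn {X α : Type*} [TopologicalSpace X] [UniformSpace α]
    {l : Filter ι} {F : ι → X → α} {f : X → α} {K : Set X} (hK : IsCompact K)
    (hF : EquicontinuousOn F K) (h_lim : ∀ x ∈ K, Tendsto (fun i => F i x) l (𝓝 (f x))) :
    TendstoUniformlyOn F f l K := by
  refine UniformOnFun.tendsto_iff_tendstoUniformlyOn.1
    ((EquicontinuousOn.tendsto_uniformOnFun_iff_pi' (𝔖 := {K}) (forall_eq.2 hK) (forall_eq.2 hF)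
      l f).2 (tendsto_pi_nhds.2 fun x => h_lim x ?_)) K rfl
  simpa only [sUnion_singleton] using x.2

variable {E : Type*} [NormedAddCommGroup E] [NormedSpace ℂ E] {F : ι → ℂ → E} {U : Set ℂ}

lemma equicontinuousOn_of_differentiableOn_of_norm_le (hU : IsOpen U)
    (hF : ∀ i, DifferentiableOn ℂ (F i) U)
    (hF_bdd : ∀ K ⊆ U, IsCompact K → ∃ B, ∀ i, ∀ z ∈ K, ‖F i z‖ ≤ B) : EquicontinuousOn F U := by
  intro z₀ hz₀
  obtain ⟨r, hr, hrU⟩ := Metric.nhds_basis_closedBall.mem_iff.1 (hU.mem_nhds hz₀)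
  obtain ⟨B, hB⟩ := hF_bdd _ hrU (isCompact_closedBall z₀ r)
  have h_maps : ∀ i, MapsTo (F i) (Metric.ball z₀ r) (Metric.closedBall (F i z₀) (B + B)) :=
    fun i z hz => mem_closedBall_iff_norm.2 ((norm_sub_le _ _).trans
      (add_le_add (hB i z (Metric.ball_subset_closedBall hz))
        (hB i z₀ (Metric.mem_closedBall_self hr.le))))
  have h_modulus : Tendsto (fun z => (B + B) / r * dist z z₀) (𝓝 z₀) (𝓝 0) := by
    simpa only [id, mul_zero] using (tendsto_iff_dist_tendsto_zero.1 tendsto_id).const_mul _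
  refine (Metric.equicontinuousAt_of_continuity_modulus _ h_modulus F ?_).equicontinuousWithinAt _
  filter_upwards [Metric.ball_mem_nhds z₀ hr] with z hz i
  rw [dist_comm]
  exact Complex.dist_le_div_mul_dist_of_mapsTo_ball
    ((hF i).mono (Metric.ball_subset_closedBall.trans hrU)) (h_maps i) hz

theorem tendstoLocallyUniformlyOn_of_differentiableOn_of_norm_le {l : Filter ι} {f : ℂ → E}
    (hU : IsOpen U) (hF : ∀ i, DifferentiableOn ℂ (F i) U)
    (hF_bdd : ∀ K ⊆ U, IsCompact K → ∃ B, ∀ i, ∀ z ∈ K, ‖F i z‖ ≤ B)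
    (h_lim : ∀ z ∈ U, Tendsto (fun i => F i z) l (𝓝 (f z))) :
    TendstoLocallyUniformlyOn F f l U :=
  (tendstoLocallyUniformlyOn_iff_forall_isCompact hU).2 fun _ hKU hK =>
    tendstoUniformlyOn_of_equicontinuousOn hK
      ((equicontinuousOn_of_differentiableOn_of_norm_le hU hF hF_bdd).mono hKU)
      fun z hz => h_lim z (hKU hz)

end LocallyUniform

namespace Disk

variable {f : Disk → ℂ} {φ : Disk → Disk}

lemma analytic_iff_differentiableOn_extend :
    Analytic f ↔ DifferentiableOn ℂ (Function.extend Subtype.val f 0) (Metric.ball 0 1) := by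
  refine ⟨fun ⟨F, hF, h⟩ => hF.congr fun z hz => ?_,
    fun h => ⟨_, h, fun z => (Subtype.val_injective.extend_apply f 0 z).symm⟩⟩
  exact (Subtype.val_injective.extend_apply f 0 ⟨z, hz⟩).trans (h _)

lemma continuous_of_analytic_coe (hφ : Analytic fun z => (φ z : ℂ)) : Continuous φ :=
  continuous_induced_rng.2 hφ.continuous

lemma Analytic.comp (hf : Analytic f) (hφ : Analytic fun z => (φ z : ℂ)) : Analytic (f ∘ φ) := by
  obtain ⟨F, hF, h⟩ := hf
  obtain ⟨Φ, hΦ, hφΦ⟩ := hφ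
  refine ⟨F ∘ Φ, hF.comp hΦ fun z hz => ?_, fun z => ?_⟩
  · rw [← hφΦ ⟨z, hz⟩]
    exact (φ _).2
  · rw [Function.comp_apply, Function.comp_apply, h]
    exact congrArg F (hφΦ z)

end Disk

/-- The analytic functions on the disk satisfying the growth bound of the unit ball of `𝓑^Ψ`. As a
subset of `Disk → ℂ` it carries the topology of pointwise convergence, in which it is compact. -/
def growthClass (Ψ : OrliczFunction) : Set (Disk → ℂ) :=
  {f | Disk.Analytic f ∧ ∀ w, ‖f w‖ ≤ Ψ.growthBound w}

section GrowthClass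

variable {Ψ : OrliczFunction}

lemma tendstoLocallyUniformlyOn_growthClass_extend {l : Filter (growthClass Ψ)} {f : Disk → ℂ}
    (hl : Tendsto Subtype.val l (𝓝 f)) :
    TendstoLocallyUniformlyOn (fun g : growthClass Ψ => Function.extend Subtype.val g.1 0)
      (Function.extend Subtype.val f 0) l (Metric.ball 0 1) := by
  refine tendstoLocallyUniformlyOn_of_differentiableOn_of_norm_le Metric.isOpen_ball
    (fun g => Disk.analytic_iff_differentiableOn_extend.1 g.2.1) (fun K hK_sub hK => ?_)
    fun z hz => ?_
  · obtain ⟨B, hB⟩ := Ψ.exists_growthBound_le_of_isCompact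
      (IsInducing.subtypeVal.isCompact_preimage' hK (hK_sub.trans_eq Subtype.range_coe.symm))
    refine ⟨B, fun g z hz => ?_⟩
    lift z to Disk using hK_sub hz
    rw [Subtype.val_injective.extend_apply]
    exact (g.2.2 z).trans (hB z hz)
  · lift z to Disk using hz
    simp only [Subtype.val_injective.extend_apply]
    exact tendsto_pi_nhds.1 hl z

lemma tendstoUniformlyOn_growthClass {l : Filter (growthClass Ψ)} {f : Disk → ℂ}
    (hl : Tendsto Subtype.val l (𝓝 f)) {K : Set Disk} (hK : IsCompact K) :
    TendstoUniformlyOn (fun g : growthClass Ψ => g.1) f l K := by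
  have h_image := ((tendstoLocallyUniformlyOn_iff_forall_isCompact Metric.isOpen_ball).1
    (tendstoLocallyUniformlyOn_growthClass_extend hl) (Subtype.val '' K)
    (image_subset_iff.2 fun z _ => z.2) (hK.image continuous_subtype_val)).comp
    (Subtype.val : Disk → ℂ)
  have h_extend : ∀ g : Disk → ℂ, Function.extend Subtype.val g 0 ∘ Subtype.val = g :=
    fun g => Function.extend_comp Subtype.val_injective g 0
  simp only [h_extend] at h_image
  exact h_image.mono (subset_preimage_image _ _)

lemma isClosed_growthClass : IsClosed (growthClass Ψ) := by
  refine isClosed_of_closure_subset fun f hf => ?_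
  have := mem_closure_iff_comap_neBot.1 hf
  have hl : Tendsto (Subtype.val : growthClass Ψ → Disk → ℂ) (comap Subtype.val (𝓝 f)) (𝓝 f) :=
    tendsto_comap
  refine ⟨Disk.analytic_iff_differentiableOn_extend.2 ?_, fun w =>
    le_of_tendsto (tendsto_pi_nhds.1 hl w).norm (Eventually.of_forall fun g => g.2.2 w)⟩
  exact (tendstoLocallyUniformlyOn_growthClass_extend hl).differentiableOn
    (Eventually.of_forall fun g => Disk.analytic_iff_differentiableOn_extend.1 g.2.1)
    Metric.isOpen_ball

variable (Ψ) in
lemma isCompact_growthClass : IsCompact (growthClass Ψ) :=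
  (isCompact_univ_pi fun w => isCompact_closedBall (0 : ℂ) (Ψ.growthBound w)).of_isClosed_subset
    isClosed_growthClass fun _ hf w _ => mem_closedBall_zero_iff.2 (hf.2 w)

end GrowthClass

namespace OrliczFunction

variable {Ψ : OrliczFunction}

lemma DeltaSq.exists_pow_le (h : Ψ.DeltaSq) (n : ℕ) :
    ∃ β > 0, ∀ᶠ x in atTop, Ψ (β * x) ^ 2 ^ n ≤ Ψ x := by
  obtain ⟨α, hα, hΔ⟩ := h
  have hα_pos : 0 < α := one_pos.trans hα
  induction n with
  | zero => exact ⟨1, one_pos, Eventually.of_forall fun x => by simp⟩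
  | succ n ih =>
    obtain ⟨β, hβ, h_pow⟩ := ih
    refine ⟨α⁻¹ * β, by positivity, ?_⟩
    filter_upwards [h_pow, (tendsto_id.const_mul_atTop (by positivity : 0 < α⁻¹ * β)).eventually hΔ]
      with x hx hx_sq
    rw [id, mul_assoc, mul_inv_cancel_left₀ hα_pos.ne'] at hx_sq
    calc Ψ (α⁻¹ * β * x) ^ 2 ^ (n + 1) = (Ψ (α⁻¹ * (β * x)) ^ 2) ^ 2 ^ n := by
          rw [← pow_mul, pow_succ', mul_assoc]
      _ ≤ Ψ (β * x) ^ 2 ^ n := by gcongr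
      _ ≤ Ψ x := hx

/-- The growth bound of the unit ball of `𝓑^Ψ` lies in the Orlicz space `L^Ψ(𝔻, 𝒜)`. -/
def GrowthBoundMemOrlicz (Ψ : OrliczFunction) : Prop :=
  ∃ C : ℝ, 0 < C ∧ orliczModular Ψ (fun z => (Ψ.growthBound z : ℂ)) C < ⊤

lemma orliczModular_growthBound (C : ℝ) :
    orliczModular Ψ (fun z => (Ψ.growthBound z : ℂ)) C =
      ∫⁻ z, ENNReal.ofReal (Ψ (Ψ.growthBound z / C)) ∂Disk.area :=
  lintegral_congr fun z => by rw [Complex.norm_of_nonneg (Ψ.growthBound_pos z).le]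

lemma DeltaSq.eventually_apply_growthBound_le (h : Ψ.DeltaSq) : ∃ β > 0, ∀ᶠ z in cocompact Disk,
    Ψ (β * Ψ.growthBound z) ≤ (1 - ‖(z : ℂ)‖) ^ (-1 / 2 : ℝ) := by
  obtain ⟨β, hβ, h_pow⟩ := h.exists_pow_le 2
  refine ⟨β, hβ, (Ψ.tendsto_growthBound.eventually h_pow).mono fun z hz => ?_⟩
  have hz_pos := z.one_sub_norm_pos
  rw [apply_growthBound] at hz
  refine le_of_pow_le_pow_left₀ (n := 2 ^ 2) (by norm_num) (by positivity) (hz.trans_eq ?_)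
  rw [← Real.rpow_mul_natCast hz_pos.le, one_div, ← Real.rpow_natCast, ← Real.rpow_neg hz_pos.le]
  norm_num

end OrliczFunction

lemma Disk.lintegral_one_sub_norm_rpow_lt_top {s : ℝ} (hs : -1 < s) :
    ∫⁻ z : Disk, ENNReal.ofReal ((1 - ‖(z : ℂ)‖) ^ s) ∂area < ⊤ := by
  have h_radial : IntervalIntegrable (fun r : ℝ => r * (1 - r) ^ s) volume 0 1 := by
    have h_rpow := (intervalIntegral.intervalIntegrable_rpow' (a := 0) (b := 1) hs).comp_sub_left 1
    rw [sub_zero, sub_self] at h_rpow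
    exact h_rpow.symm.continuousOn_mul continuousOn_id
  have h_int : IntegrableOn (fun z : ℂ => (1 - ‖z‖) ^ s) (Metric.ball 0 1) := by
    refine (integrableOn_fun_norm_addHaar volume (f := fun r : ℝ => (1 - r) ^ s)).2 ?_
    rw [intervalIntegrable_iff_integrableOn_Ioo_of_le zero_le_one] at h_radial
    simpa only [Complex.finrank_real_complex, Nat.add_one_sub_one, pow_one, smul_eq_mul]
      using h_radial
  rw [lintegral_area fun z => ENNReal.ofReal ((1 - ‖z‖) ^ s)]
  exact ENNReal.mul_lt_top (by simpa using Real.pi_pos) h_int.lintegral_lt_top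

theorem OrliczFunction.DeltaSq.growthBoundMemOrlicz {Ψ : OrliczFunction} (h : Ψ.DeltaSq) :
    Ψ.GrowthBoundMemOrlicz := by
  obtain ⟨β, hβ, h_ev⟩ := h.eventually_apply_growthBound_le
  obtain ⟨K, hK, hK_le⟩ := hasBasis_cocompact.eventually_iff.1 h_ev
  obtain ⟨B, hB⟩ := Ψ.exists_growthBound_le_of_isCompact hK
  have h_point : ∀ z, ENNReal.ofReal (Ψ (Ψ.growthBound z / β⁻¹)) ≤
      ENNReal.ofReal (Ψ (β * B)) + ENNReal.ofReal ((1 - ‖(z : ℂ)‖) ^ (-1 / 2 : ℝ)) := fun z => by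
    have hz := Ψ.growthBound_pos z
    rw [div_inv_eq_mul, mul_comm]
    by_cases hzK : z ∈ K
    · refine le_add_right (ENNReal.ofReal_le_ofReal ?_)
      have h_mul := mul_le_mul_of_nonneg_left (hB z hzK) hβ.le
      exact Ψ.monotoneOn' (mem_Ici.2 (by positivity))
        (mem_Ici.2 (le_trans (by positivity) h_mul)) h_mul
    · exact le_add_left (ENNReal.ofReal_le_ofReal (hK_le hzK))
  refine ⟨β⁻¹, _root_.inv_pos.2 hβ, ?_⟩
  rw [orliczModular_growthBound]
  refine (lintegral_mono h_point).trans_lt ?_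
  rw [lintegral_add_left measurable_const, lintegral_const, measure_univ, mul_one]
  exact ENNReal.add_lt_top.2
    ⟨ENNReal.ofReal_lt_top, Disk.lintegral_one_sub_norm_rpow_lt_top (by norm_num)⟩

section Sufficiency

variable {Ψ : OrliczFunction} {φ : Disk → Disk} {f : Disk → ℂ}

lemma OrliczFunction.GrowthBoundMemOrlicz.exists_orliczModular_le_half
    (hG : Ψ.GrowthBoundMemOrlicz) :
    ∃ D > 0, orliczModular Ψ (fun z => (Ψ.growthBound z : ℂ)) D ≤ 2⁻¹ := by
  obtain ⟨C, hC, h_lt⟩ := hG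
  obtain ⟨C₁, hC₁, h_le⟩ := exists_orliczModular_le_one Ψ hC h_lt
  refine ⟨C₁ * 2, by positivity, (orliczModular_mul_le Ψ _ hC₁ one_le_two).trans ?_⟩
  rw [ENNReal.ofReal_inv_of_pos two_pos, ENNReal.ofReal_ofNat]
  exact mul_le_of_le_one_right' h_le

lemma Disk.Analytic.mem_bergmanOrliczSubmodule (hf : Disk.Analytic f)
    (hG : Ψ.GrowthBoundMemOrlicz) {M : ℝ} (h : ∀ z, ‖f z‖ ≤ M * Ψ.growthBound z) :
    f ∈ bergmanOrliczSubmodule Ψ := by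
  obtain ⟨C, hC, h_lt⟩ := hG
  have hM : 0 < max M 1 := lt_max_of_lt_right one_pos
  refine ⟨hf, max M 1 * C, by positivity, lt_of_le_of_lt ?_ h_lt⟩
  rw [OrliczFunction.orliczModular_growthBound]
  refine lintegral_mono fun z => ENNReal.ofReal_le_ofReal ?_
  have hz := Ψ.growthBound_pos z
  refine Ψ.monotoneOn' (mem_Ici.2 (by positivity)) (mem_Ici.2 (by positivity)) ?_
  rw [← div_div]
  refine div_le_div_of_nonneg_right ((div_le_iff₀' hM).2 ((h z).trans ?_)) hC.le
  gcongr
  exact le_max_left M 1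

lemma BergmanCompactCondition.comp_mem_bergmanOrliczSubmodule (h : BergmanCompactCondition Ψ φ)
    (hφ : Disk.Analytic fun z => (φ z : ℂ)) (hG : Ψ.GrowthBoundMemOrlicz) (hf : Disk.Analytic f)
    {N : ℝ} (hN : 0 ≤ N) (hfN : ∀ w, ‖f w‖ ≤ N * Ψ.growthBound w) :
    f ∘ φ ∈ bergmanOrliczSubmodule Ψ := by
  obtain ⟨M, hM⟩ := h.exists_growthBound_comp_le (Disk.continuous_of_analytic_coe hφ)
  refine (hf.comp hφ).mem_bergmanOrliczSubmodule hG (M := N * M) fun z => ?_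
  rw [mul_assoc]
  exact (hfN (φ z)).trans (mul_le_mul_of_nonneg_left (hM z) hN)

lemma BergmanCompactCondition.exists_orliczModular_comp_le_one (h : BergmanCompactCondition Ψ φ)
    (hφ : Continuous φ) (hG : Ψ.GrowthBoundMemOrlicz) (N : ℝ) {η : ℝ} (hη : 0 < η) :
    ∃ K : Set Disk, IsCompact K ∧ ∃ δ > 0, ∀ f : Disk → ℂ,
      (∀ w, ‖f w‖ ≤ N * Ψ.growthBound w) → (∀ w ∈ K, ‖f w‖ ≤ δ) →
        orliczModular Ψ (f ∘ φ) η ≤ 1 := by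
  obtain ⟨D, hD, h_half⟩ := hG.exists_orliczModular_le_half
  have h_small : ∀ᶠ z in comap φ (cocompact Disk),
      N * (Ψ.growthBound (φ z) / Ψ.growthBound z) < η / D :=
    ((h.tendsto_comap hφ).const_mul N).eventually_lt_const (by rw [mul_zero]; positivity)
  obtain ⟨K, hK, hK_small⟩ := (hasBasis_cocompact.comap φ).eventually_iff.1 h_small
  have h_inv : 0 < Ψ.inv 2⁻¹ := OrliczFunction.inv_pos (by norm_num)
  refine ⟨K, hK, η * Ψ.inv 2⁻¹, by positivity, fun f hfN hf_small => ?_⟩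
  have h_point : ∀ z, ENNReal.ofReal (Ψ (‖(f ∘ φ) z‖ / η)) ≤
      2⁻¹ + ENNReal.ofReal (Ψ (Ψ.growthBound z / D)) := fun z => by
    by_cases hz : φ z ∈ K
    · have hz_le := (div_le_iff₀' hη).2 (hf_small _ hz)
      rw [OrliczFunction.le_inv_iff (by positivity) (by norm_num)] at hz_le
      refine le_add_right ((ENNReal.ofReal_le_ofReal hz_le).trans_eq ?_)
      rw [ENNReal.ofReal_inv_of_pos two_pos, ENNReal.ofReal_ofNat]
    · have hz_pos := Ψ.growthBound_pos z
      have hz_lt := hK_small hz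
      rw [← mul_div_assoc, div_lt_iff₀ hz_pos, div_mul_eq_mul_div, mul_div_assoc] at hz_lt
      exact le_add_left (ENNReal.ofReal_le_ofReal (Ψ.monotoneOn' (mem_Ici.2 (by positivity))
        (mem_Ici.2 (by positivity)) ((div_le_iff₀' hη).2 ((hfN _).trans hz_lt.le))))
  calc orliczModular Ψ (f ∘ φ) η
      ≤ ∫⁻ z, (2⁻¹ + ENNReal.ofReal (Ψ (Ψ.growthBound z / D))) ∂Disk.area :=
        lintegral_mono h_point
    _ = 2⁻¹ + orliczModular Ψ (fun z => (Ψ.growthBound z : ℂ)) D := by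
        rw [lintegral_add_left measurable_const, lintegral_const, measure_univ, mul_one,
          OrliczFunction.orliczModular_growthBound]
    _ ≤ 2⁻¹ + 2⁻¹ := by gcongr
    _ = 1 := ENNReal.inv_two_add_inv_two

lemma BergmanCompactCondition.continuous_growthClass_comp (h : BergmanCompactCondition Ψ φ)
    (hφ : Continuous φ) (hG : Ψ.GrowthBoundMemOrlicz) {J : growthClass Ψ → BergmanOrlicz Ψ}
    (hJ : ∀ f, (J f : Disk → ℂ) = f.1 ∘ φ) : Continuous J := by
  refine continuous_iff_continuousAt.2 fun f => Metric.tendsto_nhds.2 fun ε hε => ?_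
  obtain ⟨K, hK, δ, hδ, h_modular⟩ :=
    h.exists_orliczModular_comp_le_one hφ hG 2 (half_pos hε)
  filter_upwards [Metric.tendstoUniformlyOn_iff.1
    (tendstoUniformlyOn_growthClass (continuous_subtype_val.tendsto f) hK) δ hδ] with g hg
  have h_comp : (J g - J f : BergmanOrlicz Ψ).1 = (g.1 - f.1) ∘ φ :=
    congrArg₂ (· - ·) (hJ g) (hJ f)
  rw [dist_eq_norm]
  refine (BergmanOrlicz.norm_le_of_orliczModular_le_one _ (half_pos hε) ?_).trans_lt
    (half_lt_self hε)
  rw [h_comp]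
  refine h_modular _ (fun w => ?_) fun w hw => ?_
  · rw [two_mul]
    exact (norm_sub_le _ _).trans (add_le_add (g.2.2 w) (f.2.2 w))
  · rw [Pi.sub_apply, ← dist_eq_norm, dist_comm]
    exact (hg w hw).le

theorem BergmanCompactCondition.isCompactCompositionOperator (h : BergmanCompactCondition Ψ φ)
    (hφ : Disk.Analytic fun z => (φ z : ℂ)) (hG : Ψ.GrowthBoundMemOrlicz) :
    IsCompactCompositionOperator Ψ φ := by
  let T : BergmanOrlicz Ψ →ₗ[ℂ] BergmanOrlicz Ψ :=
    { toFun := fun f => ⟨f.1 ∘ φ, h.comp_mem_bergmanOrliczSubmodule hφ hG f.2.1 f.norm_nonneg'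
        f.norm_apply_le⟩
      map_add' := fun _ _ => rfl
      map_smul' := fun _ _ => rfl }
  let J : growthClass Ψ → BergmanOrlicz Ψ := fun f =>
    ⟨f.1 ∘ φ, h.comp_mem_bergmanOrliczSubmodule hφ hG f.2.1 zero_le_one
      fun w => (f.2.2 w).trans_eq (one_mul _).symm⟩
  have hJ : Continuous J :=
    h.continuous_growthClass_comp (Disk.continuous_of_analytic_coe hφ) hG fun _ => rfl
  have := isCompact_iff_compactSpace.1 (isCompact_growthClass Ψ)
  have hT : IsCompactOperator T := by
    refine (isCompactOperator_iff_image_closedBall_subset_compact T one_pos).2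
      ⟨range J, isCompact_range hJ, ?_⟩
    rintro _ ⟨f, hf, rfl⟩
    exact ⟨⟨f.1, f.2.1, fun w => (f.norm_apply_le w).trans
      (mul_le_of_le_one_left (Ψ.growthBound_pos w).le (mem_closedBall_zero_iff.1 hf))⟩, rfl⟩
  exact ⟨ContinuousLinearMap.mkOfIsCompactOperator hT, fun _ _ => rfl, hT⟩

end Sufficiency

section ExpSq

namespace OrliczFunction

lemma expSq_deltaSq : expSq.DeltaSq := by
  refine ⟨2, one_lt_two, Eventually.of_forall fun x => ?_⟩
  change (Real.exp (x ^ 2) - 1) ^ 2 ≤ Real.exp ((2 * x) ^ 2) - 1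
  have h_one : 1 ≤ Real.exp (x ^ 2) := Real.one_le_exp (by positivity)
  have h_sq : Real.exp (x ^ 2) ^ 2 ≤ Real.exp ((2 * x) ^ 2) := by
    rw [← Real.exp_nat_mul]
    refine Real.exp_le_exp.2 ?_
    push_cast
    linarith [sq_nonneg x]
  linarith

lemma growthBound_expSq_sq (z : Disk) :
    expSq.growthBound z ^ 2 = Real.log (1 + 1 / (1 - ‖(z : ℂ)‖) ^ 2) := by
  have h : Real.exp (expSq.growthBound z ^ 2) - 1 = 1 / (1 - ‖(z : ℂ)‖) ^ 2 :=
    expSq.apply_growthBound z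
  rw [← h, add_sub_cancel, Real.log_exp]

lemma neg_two_mul_log_le_growthBound_expSq_sq (z : Disk) :
    -2 * Real.log (1 - ‖(z : ℂ)‖) ≤ expSq.growthBound z ^ 2 := by
  have hz := z.one_sub_norm_pos
  calc -2 * Real.log (1 - ‖(z : ℂ)‖) = Real.log (1 / (1 - ‖(z : ℂ)‖) ^ 2) := by
        rw [one_div, Real.log_inv, Real.log_pow, neg_mul, Nat.cast_ofNat]
    _ ≤ Real.log (1 + 1 / (1 - ‖(z : ℂ)‖) ^ 2) :=
        Real.log_le_log (by positivity) (le_add_of_nonneg_left zero_le_one)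
    _ = expSq.growthBound z ^ 2 := (growthBound_expSq_sq z).symm

lemma growthBound_expSq_sq_le (z : Disk) :
    expSq.growthBound z ^ 2 ≤ Real.log 2 - 2 * Real.log (1 - ‖(z : ℂ)‖) := by
  have hz := z.one_sub_norm_pos
  have h_one : 1 ≤ 1 / (1 - ‖(z : ℂ)‖) ^ 2 :=
    (one_le_div (by positivity)).2 (pow_le_one₀ hz.le z.one_sub_norm_le_one)
  calc expSq.growthBound z ^ 2 = Real.log (1 + 1 / (1 - ‖(z : ℂ)‖) ^ 2) := growthBound_expSq_sq z
    _ ≤ Real.log (2 / (1 - ‖(z : ℂ)‖) ^ 2) :=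
        Real.log_le_log (by positivity) (by linarith [add_div 1 1 ((1 - ‖(z : ℂ)‖) ^ 2)])
    _ = Real.log 2 - 2 * Real.log (1 - ‖(z : ℂ)‖) := by
        rw [Real.log_div two_ne_zero (by positivity), Real.log_pow, Nat.cast_ofNat]

end OrliczFunction

variable {φ : Disk → Disk}

lemma bergmanCompactCondition_iff_growthBound_sq_le {Ψ : OrliczFunction} (hφ : Continuous φ) :
    BergmanCompactCondition Ψ φ ↔
      ∀ ε > 0, ∃ B, ∀ z, Ψ.growthBound (φ z) ^ 2 ≤ ε * Ψ.growthBound z ^ 2 + B := by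
  constructor
  · intro h ε hε
    obtain ⟨K, hK, hK_lt⟩ := (hasBasis_cocompact.comap φ).eventually_iff.1
      ((h.tendsto_comap hφ).eventually_lt_const (Real.sqrt_pos.2 hε))
    obtain ⟨B, hB⟩ := Ψ.exists_growthBound_le_of_isCompact hK
    refine ⟨B ^ 2, fun z => ?_⟩
    have hφz := (Ψ.growthBound_pos (φ z)).le
    by_cases hz : φ z ∈ K
    · exact (pow_le_pow_left₀ hφz (hB _ hz) 2).trans (le_add_of_nonneg_left (by positivity))
    · have hz_sq := pow_le_pow_left₀ hφz ((div_lt_iff₀ (Ψ.growthBound_pos z)).1 (hK_lt hz)).le 2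
      rw [mul_pow, Real.sq_sqrt hε.le] at hz_sq
      exact hz_sq.trans (le_add_of_nonneg_right (sq_nonneg B))
  · intro h
    refine bergmanCompactCondition_iff_tendsto_cocompact.2 (Metric.tendsto_nhds.2 fun ε hε => ?_)
    obtain ⟨B, hB⟩ := h (ε ^ 2 / 2) (by positivity)
    filter_upwards [((tendsto_pow_atTop two_ne_zero).comp
      Ψ.tendsto_growthBound).eventually_gt_atTop (B / (ε ^ 2 / 2))] with z hz
    rw [Function.comp_apply, div_lt_iff₀' (by positivity)] at hz
    have hz_pos := Ψ.growthBound_pos z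
    rw [Real.dist_0_eq_abs, abs_of_pos (div_pos (Ψ.growthBound_pos _) hz_pos), div_lt_iff₀ hz_pos]
    refine lt_of_pow_lt_pow_left₀ 2 (by positivity) ?_
    rw [mul_pow]
    linarith [hB z]

lemma powerCondition_iff_neg_log_le : PowerCondition φ ↔
    ∀ ε > 0, ∃ B, ∀ z : Disk,
      -Real.log (1 - ‖(φ z : ℂ)‖) ≤ ε * -Real.log (1 - ‖(z : ℂ)‖) + B := by
  have h_log : ∀ {c : ℝ}, 0 < c → ∀ (ε : ℝ) (z : Disk),
      c * (1 - ‖(z : ℂ)‖) ^ ε ≤ 1 - ‖(φ z : ℂ)‖ ↔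
        -Real.log (1 - ‖(φ z : ℂ)‖) ≤ ε * -Real.log (1 - ‖(z : ℂ)‖) - Real.log c := by
    intro c hc ε z
    have hz := Real.rpow_pos_of_pos z.one_sub_norm_pos ε
    rw [← Real.log_le_log_iff (mul_pos hc hz) (φ z).one_sub_norm_pos, Real.log_mul hc.ne' hz.ne',
      Real.log_rpow z.one_sub_norm_pos]
    constructor <;> intro h <;> linarith
  refine forall₂_congr fun ε _ => ⟨?_, ?_⟩
  · rintro ⟨c, hc, h⟩
    exact ⟨-Real.log c, fun z => (h_log hc ε z).1 (h z)⟩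
  · rintro ⟨B, h⟩
    refine ⟨Real.exp (-B), Real.exp_pos _, fun z => (h_log (Real.exp_pos _) ε z).2 ?_⟩
    rw [Real.log_exp, sub_neg_eq_add]
    exact h z

theorem bergmanCompactCondition_expSq_iff_powerCondition (hφ : Continuous φ) :
    BergmanCompactCondition OrliczFunction.expSq φ ↔ PowerCondition φ := by
  have h_lower := OrliczFunction.neg_two_mul_log_le_growthBound_expSq_sq
  have h_upper := OrliczFunction.growthBound_expSq_sq_le
  rw [bergmanCompactCondition_iff_growthBound_sq_le hφ, powerCondition_iff_neg_log_le]
  refine forall₂_congr fun ε hε => ⟨fun ⟨B, hB⟩ => ⟨(ε * Real.log 2 + B) / 2, fun z => ?_⟩,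
    fun ⟨B, hB⟩ => ⟨Real.log 2 + 2 * B, fun z => ?_⟩⟩
  · linarith [hB z, h_lower (φ z), mul_le_mul_of_nonneg_left (h_upper z) hε.le]
  · linarith [hB z, h_upper (φ z), mul_le_mul_of_nonneg_left (h_lower z) hε.le]

end ExpSq

theorem mainTheorem11 (φ : Disk → Disk) (hφ : Disk.Analytic fun z => (φ z : ℂ)) :
    (∀ Ψ : OrliczFunction,
      (IsCompactCompositionOperator Ψ φ → BergmanCompactCondition Ψ φ) ∧
      (Ψ.DeltaSq → BergmanCompactCondition Ψ φ → IsCompactCompositionOperator Ψ φ)) ∧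
    (BergmanCompactCondition OrliczFunction.expSq φ ↔ PowerCondition φ) ∧
    (IsCompactCompositionOperator OrliczFunction.expSq φ ↔ PowerCondition φ) := by
  have h_necessary (Ψ : OrliczFunction) :
      IsCompactCompositionOperator Ψ φ → BergmanCompactCondition Ψ φ :=
    IsCompactCompositionOperator.bergmanCompactCondition
  have h_sufficient (Ψ : OrliczFunction) (hΔ : Ψ.DeltaSq) (h : BergmanCompactCondition Ψ φ) :
      IsCompactCompositionOperator Ψ φ :=
    h.isCompactCompositionOperator hφ hΔ.growthBoundMemOrlicz
  have h_power := bergmanCompactCondition_expSq_iff_powerCondition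
    (Disk.continuous_of_analytic_coe hφ)
  refine ⟨fun Ψ => ⟨h_necessary Ψ, h_sufficient Ψ⟩, h_power, ?_⟩
  exact ⟨fun h => h_power.1 (h_necessary _ h),
    fun h => h_sufficient _ OrliczFunction.expSq_deltaSq (h_power.2 h)⟩
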